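/- Let $m\ge 2$ be an integer, and let $\mu_1,\dots,\mu_m$ be Borel probability measures on $\mathbb{C}$ with $\int_{\mathbb{C}}\log_+|w|\,d\mu_k(w)<\infty$ for each $k$, where $\log_+x=\max\{\log x,0\}$. Write $U_{\mu}(z)=\int_{\mathbb{C}}\log|z-w|\,d\mu(w)\in[-\infty,\infty)$ for the logarithmic potential of $\mu$. Let $\{X_{i,k}: i\ge 1,\ 1\le k\le m\}$ be independent complex random variables on a common probability space such that $X_{i,k}$ has distribution $\mu_k$. For each $k$ let $n_k=n_k(n)$, $n\ge 1$, be a sequence of non-negative integers with $n_1=n$ and $n_k\le n$ for all $k$ and all $n$, such that the limits $c_k=\lim_{n\to\infty}n_k/n\in[0,1]$ exist. Assume that $\mu_k$ is non-degenerate (not a point mass) for every $k$ for which the sequence $(n_k)_{n\ge1}$ is unbounded. Put $$p_{n,k}(z)=\prod_{i=1}^{n_k}(z-X_{i,k}),\qquad \rho_n=\frac1n\sum_{i=1}^n\delta_{z_i^{(n)}},$$ where $z_1^{(n)},\dots,z_n^{(n)}$ are the zeros, with multiplicity, of the degree-$n$ polynomial $\sum_{k=1}^m p_{n,k}$. Let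 $U(z)=\max_{1\le k\le m}c_kU_{\mu_k}(z)$, where $c_kU_{\mu_k}$ is understood to be $0$ everywhere if $c_k=0$. Then $U$ is finite Lebesgue-almost everywhere and locally integrable, and there is a deterministic probability measure $\rho$ on $\mathbb{C}$ such that $\rho_n$ converges weakly to $\rho$ in probability as $n\to\infty$; that is, for every bounded continuous $\varphi:\mathbb{C}\to\mathbb{C}$, $\int\varphi\,d\rho_n\to\int\varphi\,d\rho$ in probability. Moreover $\rho$ is the unique probability measure on $\mathbb{C}$ with $$\int_{\mathbb{C}}\varphi\,d\rho=\frac1{2\pi}\int_{\mathbb{C}}\Delta\varphi(z)\,U(z)\,d\lambda(z)\qquad\text{for all smooth compactly supported }\varphi:\mathbb{C}\to\mathbb{C},$$ where $\lambda$ is Lebesgue measure; in particular $\rho$ depends only on $\mu_1,\dots,\mu_m$ and $c_1,\dots,c_m$. -/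

import Mathlib

open MeasureTheory ProbabilityTheory Filter Topology Polynomial
open scoped ENNReal BoundedContinuousFunction Laplacian

noncomputable section

namespace RandomPolySum

/-- The measure integrates `log₊ |w|`. -/
def HasLogMoment (μ : Measure ℂ) : Prop :=
  Integrable (fun w : ℂ => Real.posLog ‖w‖) μ

/-- The measure is not a point mass. -/
def NonDegenerate (μ : Measure ℂ) : Prop :=
  ∀ a : ℂ, μ ≠ Measure.dirac a

/-- The logarithmic potential `U_μ(z) = ∫ log |z - w| dμ(w)` with values in `[-∞, ∞]`, i.e. the
integral of the positive part minus the integral of the negative part of `w ↦ log |z - w|`.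
Here `ENNReal.log 0 = -∞`, so that an atom of `μ` at `z` gives the value `-∞`. -/
def logPotential (μ : Measure ℂ) (z : ℂ) : EReal :=
  ((∫⁻ w, (ENNReal.log ‖z - w‖ₑ).toENNReal ∂μ : ℝ≥0∞) : EReal) -
    ((∫⁻ w, (-ENNReal.log ‖z - w‖ₑ).toENNReal ∂μ : ℝ≥0∞) : EReal)

/-- The function `c U_μ`, which is `0` everywhere if `c = 0`. -/
def scaledPotential (c : ℝ) (μ : Measure ℂ) (z : ℂ) : EReal :=
  if c = 0 then 0 else (c : EReal) * logPotential μ z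

/-- The function `U = max_k c_k U_{μ_k}`. -/
def maxPotential {m : ℕ} (c : Fin m → ℝ) (μ : Fin m → Measure ℂ) (z : ℂ) : EReal :=
  ⨆ k, scaledPotential (c k) (μ k) z

open scoped ContDiff in
/-- `ρ = (1/2π) Δ U` in the sense of distributions. -/
def IsDistribLaplacian (ρ : Measure ℂ) (U : ℂ → EReal) : Prop :=
  ∀ φ : ℂ → ℂ, ContDiff ℝ ∞ φ → HasCompactSupport φ →
    ∫ z, φ z ∂ρ = (2 * Real.pi)⁻¹ • ∫ z, (U z).toReal • (Δ φ) z ∂volume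

/-- The monic polynomial with roots `x 0, …, x (d - 1)`. -/
def rootPoly (x : ℕ → ℂ) (d : ℕ) : ℂ[X] :=
  ∏ i ∈ Finset.range d, (X - C (x i))

/-- The measure `(1/n) ∑ δ_z` over the zeros `z` of `p`, counted with multiplicity. -/
def empiricalRootMeasure (n : ℕ) (p : ℂ[X]) : Measure ℂ :=
  (n : ℝ≥0∞)⁻¹ • (p.roots.map (fun z => Measure.dirac z)).sum

/-- Weak convergence in probability of random measures on `ℂ` to a deterministic measure. -/
def TendstoWeaklyInProbability {Ω : Type*} [MeasurableSpace Ω] (P : Measure Ω)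
    (ρn : ℕ → Ω → Measure ℂ) (ρ : Measure ℂ) : Prop :=
  ∀ φ : ℂ →ᵇ ℂ,
    TendstoInMeasure P (fun n ω => ∫ z, φ z ∂(ρn n ω)) atTop (fun _ => ∫ z, φ z ∂ρ)

end RandomPolySum

end

noncomputable section

namespace RandomPolySum

/-! Write `P_n` for the random polynomial and `ρ_n` for its empirical root measure. Its leading
coefficient is an integer between `1` and `m`, so up to a constant in `[0, log m]` the function `n⁻¹
log |P_n|` is the logarithmic potential of `ρ_n`, and `ρ_n` is `(2π)⁻¹ Δ (n⁻¹ log |P_n|)` in the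
sense of distributions. It suffices that `n⁻¹ log |P_n|` tends to `U` in probability, first at
almost every point and then in `L¹` of discs.

At a fixed generic `z` the strong law gives `n⁻¹ log |p_{n,k}(z)| → c_k U_{μ_k}(z)`, which yields
the upper bound at once. The lower bound must exclude cancellation. If `P_n(z)` is much smaller than
`p_{n,k}(z)`, then `log |p_{n,k}(z)|` lies within `1` of the logarithm of the modulus of the other
terms. The former is a sum of `N = n_k` independent copies of `log |z - X|`, independent of the
latter. Gaussian smoothing bounds the probability of this event by `e^{1/2} ∫ |χ|^N dγ`, where `χ`
is the characteristic function of `log |z - X|`; for non-degenerate laws and almost every `z`, `|χ|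
< 1` almost everywhere, so the bound vanishes as `N → ∞`. If instead every term of maximal exponent
has small degree, then the maximum is `0`, the remaining terms are exponentially small, and the
dominant part is one of finitely many random variables that are almost surely nonzero. This is
`tendsto_measure_norm_sum_le_exp`.

To integrate in `z`, the singular part of the kernel is square integrable, so potentials are bounded
in `L²` on discs by the logarithmic moment alone. Jensen's formula bounds that moment for `ρ_n` by
the growth of `P_n` on the unit circle, hence by `logSize`, whose mean is finite and independent of
`n`. `tendsto_measure_le_lintegral` then gives convergence in `L¹` of discs, and so convergence for
smooth test functions.

The same moment bound gives tightness. The limit `ρ` comes from the finite intersection property in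
a compact set of probability measures, each finite set of constraints being met approximately by the
root measure of a single outcome. Compactness also passes from smooth tests to bounded continuous
ones. Uniqueness holds because smooth compactly supported functions determine finite measures. -/

/-! ### The logarithmic kernel and its singular part -/

open Real in
theorem abs_log_eq_posLog_add (x : ℝ) : |log x| = log⁺ x + log⁺ x⁻¹ := by
  rcases le_total 0 (log x) with h | h
  · rw [abs_of_nonneg h]; simp [posLog, h]
  · rw [abs_of_nonpos h]; simp [posLog, h]

-- This splits the kernel into a singular part, square integrable in `z` uniformly in `w`, and a
-- remainder controlled by the logarithmic moment.
open Real in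
theorem abs_log_norm_sub_le (z w : ℂ) :
    |log ‖z - w‖| ≤ log⁺ ‖z - w‖⁻¹ + (log 2 + log⁺ ‖z‖ + log⁺ ‖w‖) := by
  rw [abs_log_eq_posLog_add]
  have h1 : log⁺ ‖z - w‖ ≤ log⁺ (‖z‖ + ‖w‖) :=
    monotoneOn_posLog (norm_nonneg _) (by simp; positivity) (norm_sub_le z w)
  have h2 := posLog_add (x := ‖z‖) (y := ‖w‖)
  linarith

-- Apply `log x ≤ x - 1` at `x = r ^ (-1/2)`. The factor `r` is the Jacobian of polar coordinates in
-- the plane.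
open Real in
theorem posLog_inv_sq_le {r : ℝ} (hr : 0 < r) : r * (log⁺ r⁻¹) ^ 2 ≤ 4 := by
  have hs : 0 < √r := sqrt_pos.2 hr
  have h : √r * log⁺ r⁻¹ ≤ 2 := by
    rcases le_total (log r⁻¹) 0 with h | h
    · simp only [posLog, max_eq_left h]; norm_num
    · simp only [posLog, max_eq_right h]
      have h1 : log r⁻¹ = 2 * log (√r)⁻¹ := by
        rw [log_inv, log_inv, log_sqrt hr.le]; ring
      have h2 : log (√r)⁻¹ ≤ (√r)⁻¹ := (log_le_sub_one_of_pos (inv_pos.2 hs)).trans (by linarith)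
      rw [h1]
      calc √r * (2 * log (√r)⁻¹) ≤ √r * (2 * (√r)⁻¹) := by gcongr
        _ = 2 := by field_simp
  have h0 : 0 ≤ √r * log⁺ r⁻¹ := mul_nonneg hs.le posLog_nonneg
  calc r * (log⁺ r⁻¹) ^ 2 = (√r * log⁺ r⁻¹) ^ 2 := by rw [mul_pow, sq_sqrt hr.le]
    _ ≤ 2 ^ 2 := by gcongr
    _ = 4 := by norm_num

theorem measurable_posLog : Measurable Real.posLog :=
  measurable_const.max Real.measurable_log

/-- The singular part of the logarithmic kernel is square integrable on the plane. -/
theorem integrable_posLog_inv_norm_sq :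
    Integrable (fun z : ℂ => (Real.posLog ‖z‖⁻¹) ^ 2) volume := by
  have h := integrable_fun_norm_addHaar (volume : Measure ℂ)
    (f := fun r : ℝ => (Real.posLog r⁻¹) ^ 2)
  refine h.2 ?_
  have hI : IntegrableOn (fun _ : ℝ => (4 : ℝ)) (Set.Ioc 0 1) := by simp
  have h2 : Integrable ((Set.Ioc (0 : ℝ) 1).indicator fun _ : ℝ => (4 : ℝ)) :=
    (integrable_indicator_iff measurableSet_Ioc).2 hI
  refine Integrable.mono' h2.integrableOn ?_ ?_
  · exact ((measurable_id.pow_const _).smul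
      ((measurable_posLog.comp measurable_inv).pow_const 2)).aestronglyMeasurable
  · filter_upwards [ae_restrict_mem measurableSet_Ioi] with r hr
    have hr : 0 < r := hr
    rw [Complex.finrank_real_complex]
    by_cases h1 : r ≤ 1
    · rw [Set.indicator_of_mem (by exact ⟨hr, h1⟩)]
      have := posLog_inv_sq_le hr
      simpa [abs_of_pos hr] using this
    · have : Real.posLog r⁻¹ = 0 := by
        rw [Real.posLog_eq_zero_iff, abs_inv, abs_of_pos hr]
        exact inv_le_one_of_one_le₀ (le_of_not_ge h1)
      rw [Set.indicator_of_notMem (by simp [h1])]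
      simp [this]

theorem locallyIntegrable_log_norm_sub (w : ℂ) :
    LocallyIntegrable (fun z : ℂ => Real.log ‖z - w‖) volume := by
  have hmeas : Measurable (fun z : ℂ => Real.log ‖z - w‖) := by fun_prop
  refine (locallyIntegrable_iff).2 fun K hK => ?_
  obtain ⟨R, hR⟩ := hK.isBounded.exists_norm_le
  -- The singular part `t` is dominated through `t ≤ t ^ 2 + 1`, so its square integrability
  -- suffices.
  have h1 : Integrable (fun z : ℂ => (Real.posLog ‖z - w‖⁻¹) ^ 2) volume :=
    integrable_posLog_inv_norm_sq.comp_sub_right w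
  have h2 : IntegrableOn (fun _ : ℂ => 1 + (Real.log 2 + Real.posLog R + Real.posLog ‖w‖)) K :=
    continuousOn_const.integrableOn_compact hK
  refine Integrable.mono' (h1.integrableOn.add h2) hmeas.aestronglyMeasurable ?_
  filter_upwards [ae_restrict_mem hK.measurableSet] with z hz
  have h3 := abs_log_norm_sub_le z w
  have h4 : Real.posLog ‖z‖ ≤ Real.posLog R :=
    Real.monotoneOn_posLog (norm_nonneg _) ((norm_nonneg _).trans (hR z hz)) (hR z hz)
  rw [Real.norm_eq_abs]
  simp only [Pi.add_apply]
  nlinarith [sq_nonneg (Real.posLog ‖z - w‖⁻¹ - 1), sq_nonneg (Real.posLog ‖z - w‖⁻¹)]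

/-! ### Green's identity and the fundamental solution of the Laplacian -/

section Laplacian

/-- Iterated directional derivatives are the form to which integration by parts applies, one
direction at a time. -/
theorem laplacian_apply_eq_fderiv_fderiv {F : Type*} [NormedAddCommGroup F] [NormedSpace ℝ F]
    {f : ℂ → F} (hf : ContDiff ℝ 2 f) (x : ℂ) :
    (Δ f) x = fderiv ℝ (fun y => fderiv ℝ f y 1) x 1 +
      fderiv ℝ (fun y => fderiv ℝ f y Complex.I) x Complex.I := by
  have hd : DifferentiableAt ℝ (fderiv ℝ f) x :=
    ((hf.fderiv_right (m := 1) (by norm_num)).differentiable (by norm_num)) x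
  have h (v : ℂ) : fderiv ℝ (fun y => fderiv ℝ f y v) x v = fderiv ℝ (fderiv ℝ f) x v v := by
    rw [fderiv_clm_apply hd (differentiableAt_const v)]
    simp
  rw [InnerProductSpace.laplacian_eq_iteratedFDeriv_complexPlane, h, h]
  simp [iteratedFDeriv_two_apply]

theorem contDiff_fderiv_apply_const {F : Type*} [NormedAddCommGroup F] [NormedSpace ℝ F]
    {f : ℂ → F} {n m : WithTop ℕ∞} (hf : ContDiff ℝ n f) (hmn : m + 1 ≤ n) (v : ℂ) :
    ContDiff ℝ m (fun y => fderiv ℝ f y v) :=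
  (hf.fderiv_right hmn).clm_apply contDiff_const

/-- Two integrations by parts; compact support of `φ` alone removes the boundary terms, so `g` needs
no decay. -/
theorem integral_smul_fderiv_fderiv {g : ℂ → ℝ} (hg : ContDiff ℝ 2 g) {φ : ℂ → ℂ}
    (hφ : ContDiff ℝ 2 φ) (hc : HasCompactSupport φ) (v : ℂ) :
    ∫ x, g x • fderiv ℝ (fun y => fderiv ℝ φ y v) x v =
      ∫ x, fderiv ℝ (fun y => fderiv ℝ g y v) x v • φ x := by
  have hφ' : ContDiff ℝ 1 (fun y => fderiv ℝ φ y v) :=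
    contDiff_fderiv_apply_const hφ (by norm_num) v
  have hφ'' : ContDiff ℝ 0 (fun x => fderiv ℝ (fun y => fderiv ℝ φ y v) x v) :=
    contDiff_fderiv_apply_const hφ' (by norm_num) v
  have hg' : ContDiff ℝ 1 (fun y => fderiv ℝ g y v) :=
    contDiff_fderiv_apply_const hg (by norm_num) v
  have hg'' : ContDiff ℝ 0 (fun x => fderiv ℝ (fun y => fderiv ℝ g y v) x v) :=
    contDiff_fderiv_apply_const hg' (by norm_num) v
  have hc' : HasCompactSupport (fun y => fderiv ℝ φ y v) := hc.fderiv_apply ℝ v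
  have hc'' : HasCompactSupport (fun x => fderiv ℝ (fun y => fderiv ℝ φ y v) x v) :=
    hc'.fderiv_apply ℝ v
  have hint {a : ℂ → ℝ} {b : ℂ → ℂ} (ha : Continuous a) (hb : Continuous b)
      (hbc : HasCompactSupport b) : Integrable (fun x => a x • b x) volume :=
    (ha.smul hb).integrable_of_hasCompactSupport hbc.smul_left
  rw [integral_smul_fderiv_eq_neg_fderiv_smul_of_integrable
      (hint hg'.continuous hφ'.continuous hc') (hint hg.continuous hφ''.continuous hc'')
      (hint hg.continuous hφ'.continuous hc')
      (fun x _ => hg.differentiable (by norm_num) x)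
      (fun x _ => hφ'.differentiable (by norm_num) x),
    integral_smul_fderiv_eq_neg_fderiv_smul_of_integrable
      (hint hg''.continuous hφ.continuous hc) (hint hg'.continuous hφ'.continuous hc')
      (hint hg'.continuous hφ.continuous hc)
      (fun x _ => hg'.differentiable (by norm_num) x)
      (fun x _ => hφ.differentiable (by norm_num) x), neg_neg]

theorem continuous_laplacian {φ : ℂ → ℂ} (hφ : ContDiff ℝ 2 φ) : Continuous (Δ φ) := by
  have : Δ φ = fun x => fderiv ℝ (fun y => fderiv ℝ φ y 1) x 1 +
      fderiv ℝ (fun y => fderiv ℝ φ y Complex.I) x Complex.I :=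
    funext fun x => laplacian_apply_eq_fderiv_fderiv hφ x
  rw [this]
  have h (v : ℂ) : ContDiff ℝ 0 (fun x => fderiv ℝ (fun y => fderiv ℝ φ y v) x v) :=
    contDiff_fderiv_apply_const (contDiff_fderiv_apply_const hφ (m := 1) (by norm_num) v)
      (by norm_num) v
  exact (h 1).continuous.add (h Complex.I).continuous

theorem hasCompactSupport_laplacian {φ : ℂ → ℂ} (hφ : ContDiff ℝ 2 φ)
    (hc : HasCompactSupport φ) : HasCompactSupport (Δ φ) := by
  have : Δ φ = (fun x => fderiv ℝ (fun y => fderiv ℝ φ y 1) x 1) +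
      fun x => fderiv ℝ (fun y => fderiv ℝ φ y Complex.I) x Complex.I :=
    funext fun x => laplacian_apply_eq_fderiv_fderiv hφ x
  rw [this]
  exact ((hc.fderiv_apply ℝ 1).fderiv_apply ℝ 1).add
    ((hc.fderiv_apply ℝ Complex.I).fderiv_apply ℝ Complex.I)

/-- The Laplacian is symmetric: Green's identity for a compactly supported test function. -/
theorem integral_smul_laplacian {g : ℂ → ℝ} (hg : ContDiff ℝ 2 g) {φ : ℂ → ℂ}
    (hφ : ContDiff ℝ 2 φ) (hc : HasCompactSupport φ) :
    ∫ x, g x • (Δ φ) x = ∫ x, (Δ g) x • φ x := by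
  have hint {a : ℂ → ℝ} {b : ℂ → ℂ} (ha : Continuous a) (hb : Continuous b)
      (hbc : HasCompactSupport b) : Integrable (fun x => a x • b x) volume :=
    (ha.smul hb).integrable_of_hasCompactSupport hbc.smul_left
  have hφ'' (v : ℂ) : ContDiff ℝ 0 (fun x => fderiv ℝ (fun y => fderiv ℝ φ y v) x v) :=
    contDiff_fderiv_apply_const (contDiff_fderiv_apply_const hφ (m := 1) (by norm_num) v)
      (by norm_num) v
  have hg'' (v : ℂ) : ContDiff ℝ 0 (fun x => fderiv ℝ (fun y => fderiv ℝ g y v) x v) :=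
    contDiff_fderiv_apply_const (contDiff_fderiv_apply_const hg (m := 1) (by norm_num) v)
      (by norm_num) v
  have hc'' (v : ℂ) : HasCompactSupport (fun x => fderiv ℝ (fun y => fderiv ℝ φ y v) x v) :=
    (hc.fderiv_apply ℝ v).fderiv_apply ℝ v
  simp_rw [laplacian_apply_eq_fderiv_fderiv hφ, laplacian_apply_eq_fderiv_fderiv hg, smul_add,
    add_smul]
  rw [integral_add (hint hg.continuous (hφ'' _).continuous (hc'' _))
      (hint hg.continuous (hφ'' _).continuous (hc'' _)),
    integral_add (hint (hg'' _).continuous hφ.continuous hc)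
      (hint (hg'' _).continuous hφ.continuous hc),
    integral_smul_fderiv_fderiv hg hφ hc, integral_smul_fderiv_fderiv hg hφ hc]

/-- Additive constants in a potential are therefore invisible to its distributional Laplacian; this
is what discards the leading coefficient of the random polynomial. -/
theorem integral_laplacian_eq_zero {φ : ℂ → ℂ} (hφ : ContDiff ℝ 2 φ)
    (hc : HasCompactSupport φ) : ∫ x, (Δ φ) x = 0 := by
  have h := integral_smul_laplacian (g := fun _ => (1 : ℝ)) contDiff_const hφ hc
  simpa [InnerProductSpace.laplacian_const] using h

/-- The smooth regularisation `½ log (|z - w|² + a)` of the logarithmic kernel. -/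
def regLog (a : ℝ) (w z : ℂ) : ℝ := 2⁻¹ * Real.log (‖z - w‖ ^ 2 + a)

theorem contDiff_regLog {a : ℝ} (ha : 0 < a) (w : ℂ) : ContDiff ℝ 2 (regLog a w) := by
  unfold regLog
  refine contDiff_const.mul (ContDiff.log ?_ fun z => by positivity)
  exact ((contDiff_id.sub contDiff_const).norm_sq ℝ).add contDiff_const

theorem fderiv_regLog {a : ℝ} (ha : 0 < a) (w z v : ℂ) :
    fderiv ℝ (regLog a w) z v = inner ℝ (z - w) v / (‖z - w‖ ^ 2 + a) := by
  have h1 : HasFDerivAt (fun z : ℂ => ‖z - w‖ ^ 2 + a) _ z :=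
    ((hasFDerivAt_id z).sub_const w).norm_sq.add_const a
  have h2 := (h1.log (by positivity)).const_mul (2⁻¹ : ℝ)
  have h3 : fderiv ℝ (regLog a w) z = _ := h2.fderiv
  rw [h3]
  simp
  field_simp
  ring

/-- The result is a positive bump of width `√a` around `w`, of total mass `2π` independent of `a`:
an approximate identity. -/
theorem laplacian_regLog {a : ℝ} (ha : 0 < a) (w z : ℂ) :
    (Δ (regLog a w)) z = 2 * a / (‖z - w‖ ^ 2 + a) ^ 2 := by
  have key (v : ℂ) : fderiv ℝ (fun y => fderiv ℝ (regLog a w) y v) z v =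
      ‖v‖ ^ 2 / (‖z - w‖ ^ 2 + a) - 2 * (inner ℝ (z - w) v) ^ 2 / (‖z - w‖ ^ 2 + a) ^ 2 := by
    simp_rw [fderiv_regLog ha]
    have h1 : HasFDerivAt (fun z : ℂ => ‖z - w‖ ^ 2 + a) _ z :=
      ((hasFDerivAt_id z).sub_const w).norm_sq.add_const a
    have h0 : HasFDerivAt (fun z : ℂ => inner ℝ (z - w) v) _ z :=
      ((hasFDerivAt_id z).sub_const w).inner ℝ (hasFDerivAt_const v z)
    have hne : ‖z - w‖ ^ 2 + a ≠ 0 := by positivity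
    have h2 := (h0.mul ((hasDerivAt_inv hne).comp_hasFDerivAt z h1)).fderiv
    simp only [div_eq_mul_inv]
    have h3 : fderiv ℝ (fun y : ℂ => inner ℝ (y - w) v * (‖y - w‖ ^ 2 + a)⁻¹) z = _ := h2
    rw [h3]
    simp
    field_simp
    ring
  rw [laplacian_apply_eq_fderiv_fderiv (contDiff_regLog ha w), key, key]
  have h4 : ‖z - w‖ ^ 2 = (z - w).re ^ 2 + (z - w).im ^ 2 := by
    rw [← Complex.normSq_eq_norm_sq, Complex.normSq_apply]; ring
  have hne : ‖z - w‖ ^ 2 + a ≠ 0 := by positivity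
  have h5 : (inner ℝ (z - w) (1 : ℂ)) ^ 2 + (inner ℝ (z - w) Complex.I) ^ 2 = ‖z - w‖ ^ 2 := by
    rw [h4]; simp [Complex.inner]; ring
  have h6 : (inner ℝ (z - w) Complex.I) ^ 2 = ‖z - w‖ ^ 2 - (inner ℝ (z - w) (1 : ℂ)) ^ 2 := by
    linarith
  rw [h6]
  simp only [norm_one, Complex.norm_I]
  field_simp
  ring

/-- In polar coordinates the radial integrand has primitive `-(r² + 1)⁻¹`, with total increment `1`;
the circle contributes `2π`. -/
theorem integral_two_div_norm_sq_add_one_sq :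
    ∫ y : ℂ, 2 / (‖y‖ ^ 2 + 1) ^ 2 = 2 * Real.pi ∧
      Integrable (fun y : ℂ => 2 / (‖y‖ ^ 2 + 1) ^ 2) volume := by
  have hderiv : ∀ x ∈ Set.Ioi (0 : ℝ), HasDerivAt (fun x : ℝ => -(x ^ 2 + 1)⁻¹)
      (x ^ (2 - 1) • (2 / (x ^ 2 + 1) ^ 2)) x := by
    intro x _
    have hne : x ^ 2 + 1 ≠ 0 := by positivity
    have h1 : HasDerivAt (fun x : ℝ => x ^ 2 + 1) (2 * x) x := by
      simpa using (hasDerivAt_pow 2 x).add_const (1 : ℝ)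
    have h2 := (h1.inv hne).neg
    refine h2.congr_deriv ?_
    simp only [smul_eq_mul]
    field_simp
    simp
  have hcont : ContinuousWithinAt (fun x : ℝ => -(x ^ 2 + 1)⁻¹) (Set.Ici 0) 0 :=
    Continuous.continuousWithinAt
      (Continuous.neg (Continuous.inv₀ (by fun_prop) fun x => by positivity))
  have hlim : Tendsto (fun x : ℝ => -(x ^ 2 + 1)⁻¹) atTop (𝓝 (-0)) :=
    (tendsto_inv_atTop_zero.comp (tendsto_atTop_add_const_right _ _
      (tendsto_pow_atTop two_ne_zero))).neg
  have hpos : ∀ x ∈ Set.Ioi (0 : ℝ), 0 ≤ x ^ (2 - 1) • (2 / (x ^ 2 + 1) ^ 2) := by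
    intro x hx
    have : (0 : ℝ) < x := hx
    simp only [smul_eq_mul]; positivity
  have hI := integrableOn_Ioi_deriv_of_nonneg hcont hderiv hpos hlim
  have hV := integral_Ioi_of_hasDerivAt_of_nonneg hcont hderiv hpos hlim
  constructor
  · rw [integral_fun_norm_addHaar volume (fun r : ℝ => 2 / (r ^ 2 + 1) ^ 2),
      Complex.finrank_real_complex, hV]
    simp [Measure.real, Complex.volume_ball]
  · rw [integrable_fun_norm_addHaar volume (f := fun r : ℝ => 2 / (r ^ 2 + 1) ^ 2),
      Complex.finrank_real_complex]
    exact hI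

/-- The substitution `z = w + ε y` moves all dependence on `ε` into the argument of `φ`, leaving a
fixed integrable kernel for dominated convergence. -/
theorem tendsto_integral_laplacian_regLog {φ : ℂ → ℂ} (hφ : Continuous φ)
    (hc : HasCompactSupport φ) (w : ℂ) {ε : ℕ → ℝ} (hε : ∀ n, 0 < ε n)
    (hlim : Tendsto ε atTop (𝓝 0)) :
    Tendsto (fun n => ∫ z, (Δ (regLog (ε n ^ 2) w)) z • φ z) atTop
      (𝓝 ((2 * Real.pi) • φ w)) := by
  have hrew (n : ℕ) : ∫ z, (Δ (regLog (ε n ^ 2) w)) z • φ z =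
      ∫ y : ℂ, (2 / (‖y‖ ^ 2 + 1) ^ 2) • φ (ε n • y + w) := by
    have h0 := hε n
    have h1 : ∫ z, (Δ (regLog (ε n ^ 2) w)) z • φ z =
        ∫ z : ℂ, (2 * ε n ^ 2 / (‖z‖ ^ 2 + ε n ^ 2) ^ 2) • φ (z + w) := by
      rw [← integral_add_right_eq_self _ w]
      simp [laplacian_regLog (pow_pos h0 2)]
    rw [h1]
    have h2 := Measure.integral_comp_smul_of_nonneg (volume : Measure ℂ)
      (fun z : ℂ => (2 * ε n ^ 2 / (‖z‖ ^ 2 + ε n ^ 2) ^ 2) • φ (z + w)) (ε n) (hR := h0.le)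
    rw [Complex.finrank_real_complex, eq_inv_smul_iff₀ (by positivity)] at h2
    rw [← h2, ← integral_smul]
    refine integral_congr_ae (ae_of_all _ fun y => ?_)
    simp only [smul_smul, norm_smul, Real.norm_eq_abs, abs_of_pos h0]
    congr 1
    field_simp
  simp_rw [hrew]
  obtain ⟨C, hC⟩ := hc.exists_bound_of_continuous hφ
  obtain ⟨hval, hint⟩ := integral_two_div_norm_sq_add_one_sq
  rw [← hval, ← integral_smul_const]
  refine tendsto_integral_of_dominated_convergence (fun y => 2 / (‖y‖ ^ 2 + 1) ^ 2 * C) ?_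
    (hint.mul_const C) ?_ ?_
  · intro n
    refine hint.aestronglyMeasurable.smul (Continuous.aestronglyMeasurable ?_)
    fun_prop
  · intro n
    refine ae_of_all _ fun y => ?_
    rw [norm_smul, Real.norm_of_nonneg (by positivity)]
    gcongr
    exact hC _
  · refine ae_of_all _ fun y => Tendsto.const_smul ?_ _
    have : Tendsto (fun n => ε n • y + w) atTop (𝓝 ((0 : ℝ) • y + w)) :=
      (hlim.smul_const y).add_const w
    rw [zero_smul, zero_add] at this
    exact (hφ.tendsto w).comp this

/-- For `ε ≤ 1` the regularised kernel lies between `log |z - w|` and its version at `a = 1`, both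
locally integrable, so convergence is dominated. -/
theorem tendsto_integral_regLog_smul {ψ : ℂ → ℂ} (hψ : Continuous ψ)
    (hc : HasCompactSupport ψ) (w : ℂ) {ε : ℕ → ℝ} (hε : ∀ n, 0 < ε n) (hε1 : ∀ n, ε n ≤ 1)
    (hlim : Tendsto ε atTop (𝓝 0)) :
    Tendsto (fun n => ∫ z, regLog (ε n ^ 2) w z • ψ z) atTop
      (𝓝 (∫ z, Real.log ‖z - w‖ • ψ z)) := by
  have hne : ∀ᵐ z : ℂ ∂volume, z ≠ w := by simp [ae_iff]
  have hcont (n : ℕ) : Continuous (regLog (ε n ^ 2) w) :=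
    (contDiff_regLog (pow_pos (hε n) 2) w).continuous
  have h1 : Integrable (fun z => ‖regLog 1 w z • ψ z‖) volume :=
    (((contDiff_regLog one_pos w).continuous.smul hψ).integrable_of_hasCompactSupport
      hc.smul_left).norm
  have h2 : Integrable (fun z => ‖Real.log ‖z - w‖ • ψ z‖) volume :=
    ((locallyIntegrable_log_norm_sub w).integrable_smul_right_of_hasCompactSupport hψ hc).norm
  refine tendsto_integral_of_dominated_convergence _
    (fun n => ((hcont n).smul hψ).aestronglyMeasurable) (h1.add h2) ?_ ?_
  · intro n
    filter_upwards [hne] with z hz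
    have hpos : 0 < ‖z - w‖ := norm_pos_iff.2 (sub_ne_zero.2 hz)
    have ha : ε n ^ 2 ≤ 1 := pow_le_one₀ (hε n).le (hε1 n)
    have hl : Real.log ‖z - w‖ ≤ regLog (ε n ^ 2) w z := by
      have : Real.log (‖z - w‖ ^ 2) ≤ Real.log (‖z - w‖ ^ 2 + ε n ^ 2) :=
        Real.log_le_log (by positivity) (by nlinarith [sq_nonneg (ε n)])
      rw [Real.log_pow] at this
      simp only [regLog]; push_cast at this; linarith
    have hu : regLog (ε n ^ 2) w z ≤ regLog 1 w z := by
      simp only [regLog]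
      have : Real.log (‖z - w‖ ^ 2 + ε n ^ 2) ≤ Real.log (‖z - w‖ ^ 2 + 1) :=
        Real.log_le_log (by positivity) (by linarith)
      linarith
    simp only [Pi.add_apply, norm_smul, ← add_mul]
    gcongr
    simp only [Real.norm_eq_abs]
    rw [abs_le]
    constructor
    · linarith [neg_abs_le (Real.log ‖z - w‖), abs_nonneg (regLog 1 w z)]
    · linarith [le_abs_self (regLog 1 w z), abs_nonneg (Real.log ‖z - w‖)]
  · filter_upwards [hne] with z hz
    have hpos : 0 < ‖z - w‖ := norm_pos_iff.2 (sub_ne_zero.2 hz)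
    refine Tendsto.smul_const ?_ _
    have h3 : Tendsto (fun n => ‖z - w‖ ^ 2 + ε n ^ 2) atTop (𝓝 (‖z - w‖ ^ 2)) := by
      simpa using (hlim.pow 2).const_add (‖z - w‖ ^ 2)
    have h4 := ((Real.continuousAt_log (by positivity)).tendsto.comp h3).const_mul (2⁻¹ : ℝ)
    have h5 : 2⁻¹ * Real.log (‖z - w‖ ^ 2) = Real.log ‖z - w‖ := by
      rw [Real.log_pow]; push_cast; ring
    rw [h5] at h4
    exact h4

/-- `(2π)⁻¹ log |z - w|` is a fundamental solution of the Laplacian on the plane. -/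
theorem integral_log_norm_sub_smul_laplacian {φ : ℂ → ℂ} (hφ : ContDiff ℝ 2 φ)
    (hc : HasCompactSupport φ) (w : ℂ) :
    ∫ z, Real.log ‖z - w‖ • (Δ φ) z = (2 * Real.pi) • φ w := by
  let ε : ℕ → ℝ := fun n => 1 / ((n : ℝ) + 1)
  have hε : ∀ n, 0 < ε n := fun n => by positivity
  have hε1 : ∀ n, ε n ≤ 1 := fun n => by
    rw [div_le_one (by positivity)]
    linarith [(Nat.cast_nonneg n : (0 : ℝ) ≤ n)]
  have hlim : Tendsto ε atTop (𝓝 0) := tendsto_one_div_add_atTop_nhds_zero_nat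
  have h1 := tendsto_integral_regLog_smul (continuous_laplacian hφ)
    (hasCompactSupport_laplacian hφ hc) w hε hε1 hlim
  have h2 := tendsto_integral_laplacian_regLog hφ.continuous hc w hε hlim
  simp_rw [integral_smul_laplacian (contDiff_regLog (pow_pos (hε _) 2) w) hφ hc] at h1
  exact tendsto_nhds_unique h1 h2

end Laplacian

/-! ### Logarithmic potentials of probability measures -/

theorem ennreal_add_sq_le (a b : ℝ≥0∞) : (a + b) ^ 2 ≤ 4 * (a ^ 2 + b ^ 2) := by
  have h : a + b ≤ 2 * max a b := by
    rw [two_mul]; exact add_le_add (le_max_left _ _) (le_max_right _ _)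
  have h2 : (max a b) ^ 2 ≤ a ^ 2 + b ^ 2 := by
    rcases le_total a b with hab | hab
    · rw [max_eq_right hab]; exact le_add_self
    · rw [max_eq_left hab]; exact le_self_add
  calc (a + b) ^ 2 ≤ (2 * max a b) ^ 2 := by gcongr
    _ = 4 * (max a b) ^ 2 := by ring
    _ ≤ _ := by gcongr

theorem lintegral_enorm_sq_le {α : Type*} [MeasurableSpace α] {ν : Measure α}
    [IsProbabilityMeasure ν] {f : α → ℝ} (hf : AEStronglyMeasurable f ν) :
    (∫⁻ x, ‖f x‖ₑ ∂ν) ^ 2 ≤ ∫⁻ x, ‖f x‖ₑ ^ 2 ∂ν := by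
  have h := eLpNorm_le_eLpNorm_of_exponent_le (p := 1) (q := 2) (by norm_num) hf
  rw [eLpNorm_one_eq_lintegral_enorm] at h
  calc (∫⁻ x, ‖f x‖ₑ ∂ν) ^ 2 ≤ (eLpNorm f 2 ν) ^ 2 := by gcongr
    _ = _ := by
      have := eLpNorm_nnreal_pow_eq_lintegral (f := f) (μ := ν) (p := 2) (by norm_num)
      simpa using this

/-- The real-valued logarithmic potential. -/
def realPotential (ν : Measure ℂ) (z : ℂ) : ℝ := ∫ w, Real.log ‖z - w‖ ∂ν

/-- The potential of the singular part `log₊ (1 / |z - w|)` of the logarithmic kernel. -/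
def singularPotential (ν : Measure ℂ) (z : ℂ) : ℝ≥0∞ :=
  ∫⁻ w, ‖Real.posLog ‖z - w‖⁻¹‖ₑ ∂ν

/-- The square of the `L²` norm of the singular part of the logarithmic kernel. -/
def singularMass : ℝ≥0∞ := ∫⁻ z : ℂ, ‖Real.posLog ‖z‖⁻¹‖ₑ ^ 2

theorem singularMass_ne_top : singularMass ≠ ∞ := by
  have h := integrable_posLog_inv_norm_sq.hasFiniteIntegral
  rw [hasFiniteIntegral_iff_enorm] at h
  simpa [singularMass, enorm_pow] using h.ne

theorem measurable_posLog_inv_norm_sub :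
    Measurable (fun p : ℂ × ℂ => Real.posLog ‖p.1 - p.2‖⁻¹) :=
  measurable_posLog.comp (by fun_prop)

/-- Cauchy–Schwarz, Tonelli and translation invariance. The bound is the same for every probability
measure, so it applies uniformly to the random root measures. -/
theorem lintegral_singularPotential_sq_le (ν : Measure ℂ) [IsProbabilityMeasure ν] :
    ∫⁻ z, singularPotential ν z ^ 2 ≤ singularMass := by
  have hm := measurable_posLog_inv_norm_sub
  calc ∫⁻ z, singularPotential ν z ^ 2
      ≤ ∫⁻ z, ∫⁻ w, ‖Real.posLog ‖z - w‖⁻¹‖ₑ ^ 2 ∂ν ∂volume := by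
        refine lintegral_mono fun z => lintegral_enorm_sq_le ?_
        exact (hm.comp measurable_prodMk_left).aestronglyMeasurable
    _ = ∫⁻ w, ∫⁻ z, ‖Real.posLog ‖z - w‖⁻¹‖ₑ ^ 2 ∂volume ∂ν := by
        refine lintegral_lintegral_swap (Measurable.aemeasurable ?_)
        exact hm.enorm.pow_const 2
    _ = ∫⁻ _, singularMass ∂ν := by
        refine lintegral_congr fun w => ?_
        exact lintegral_sub_right_eq_self (fun z : ℂ => ‖Real.posLog ‖z‖⁻¹‖ₑ ^ 2) w
    _ = singularMass := by simp

theorem measurable_singularPotential (ν : Measure ℂ) [SFinite ν] :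
    Measurable (singularPotential ν) :=
  Measurable.lintegral_prod_right' (f := fun p : ℂ × ℂ => ‖Real.posLog ‖p.1 - p.2‖⁻¹‖ₑ)
    measurable_posLog_inv_norm_sub.enorm

/-- A point at which the potential of `ν` is finite. -/
structure IsRegularPoint (ν : Measure ℂ) (z : ℂ) : Prop where
  singular_ne_top : singularPotential ν z ≠ ∞
  -- An atom at `z` must be excluded separately: with `Real.log 0 = 0` and `0⁻¹ = 0`, the singular
  -- potential does not see it.
  ae_ne : ∀ᵐ w ∂ν, w ≠ z

/-- The `L²` bound makes the singular potential finite almost everywhere. Points with an atom form a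
null set by Fubini, since each single point is null in the plane. -/
theorem ae_isRegularPoint (ν : Measure ℂ) [IsProbabilityMeasure ν] :
    ∀ᵐ z : ℂ, IsRegularPoint ν z := by
  have h1 : ∀ᵐ z : ℂ, singularPotential ν z ^ 2 < ∞ :=
    ae_lt_top ((measurable_singularPotential ν).pow_const 2)
      (ne_top_of_le_ne_top singularMass_ne_top (lintegral_singularPotential_sq_le ν))
  have h2 : ∀ᵐ z : ℂ, ∀ᵐ w ∂ν, w ≠ z := by
    rw [Measure.ae_ae_comm (measurableSet_eq_fun measurable_snd measurable_fst).compl]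
    refine ae_of_all _ fun w => ?_
    simp [ae_iff]
  filter_upwards [h1, h2] with z hz1 hz2
  refine ⟨fun h => ?_, hz2⟩
  simp [h] at hz1

theorem enorm_log_norm_sub_le (z w : ℂ) {R : ℝ} (hz : ‖z‖ ≤ R) :
    ‖Real.log ‖z - w‖‖ₑ ≤ ‖Real.posLog ‖z - w‖⁻¹‖ₑ +
      (ENNReal.ofReal (Real.log 2 + Real.posLog R) + ‖Real.posLog ‖w‖‖ₑ) := by
  have h4 : Real.posLog ‖z‖ ≤ Real.posLog R :=
    Real.monotoneOn_posLog (norm_nonneg _) ((norm_nonneg _).trans hz) hz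
  have h2 : 0 ≤ Real.log 2 := Real.log_nonneg (by norm_num)
  have hR : 0 ≤ Real.posLog R := Real.posLog_nonneg
  rw [Real.enorm_eq_ofReal_abs, Real.enorm_of_nonneg Real.posLog_nonneg,
    Real.enorm_of_nonneg Real.posLog_nonneg, ← ENNReal.ofReal_add (by positivity)
      Real.posLog_nonneg, ← ENNReal.ofReal_add Real.posLog_nonneg
      (add_nonneg (by positivity) Real.posLog_nonneg)]
  refine ENNReal.ofReal_le_ofReal ?_
  linarith [abs_log_norm_sub_le z w]

theorem lintegral_enorm_log_norm_sub_le (ν : Measure ℂ) [IsProbabilityMeasure ν] (z : ℂ) {R : ℝ}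
    (hz : ‖z‖ ≤ R) :
    ∫⁻ w, ‖Real.log ‖z - w‖‖ₑ ∂ν ≤ singularPotential ν z +
      (ENNReal.ofReal (Real.log 2 + Real.posLog R) + ∫⁻ w, ‖Real.posLog ‖w‖‖ₑ ∂ν) := by
  calc ∫⁻ w, ‖Real.log ‖z - w‖‖ₑ ∂ν ≤ ∫⁻ w, (‖Real.posLog ‖z - w‖⁻¹‖ₑ +
      (ENNReal.ofReal (Real.log 2 + Real.posLog R) + ‖Real.posLog ‖w‖‖ₑ)) ∂ν :=
        lintegral_mono fun w => enorm_log_norm_sub_le z w hz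
    _ = _ := by
      rw [lintegral_add_left (f := fun w => ‖Real.posLog ‖z - w‖⁻¹‖ₑ)
          ((measurable_posLog_inv_norm_sub.comp measurable_prodMk_left).enorm),
        lintegral_add_left measurable_const]
      simp [singularPotential]

theorem IsRegularPoint.integrable {ν : Measure ℂ} [IsProbabilityMeasure ν] {z : ℂ}
    (hz : IsRegularPoint ν z) (hν : HasLogMoment ν) :
    Integrable (fun w => Real.log ‖z - w‖) ν := by
  refine ⟨Measurable.aestronglyMeasurable (by fun_prop), ?_⟩
  rw [hasFiniteIntegral_iff_enorm]
  refine (lintegral_enorm_log_norm_sub_le ν z le_rfl).trans_lt ?_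
  have h1 : ∫⁻ w, ‖Real.posLog ‖w‖‖ₑ ∂ν < ∞ := hν.hasFiniteIntegral
  exact ENNReal.add_lt_top.2 ⟨hz.singular_ne_top.lt_top,
    ENNReal.add_lt_top.2 ⟨ENNReal.ofReal_lt_top, h1⟩⟩

theorem IsRegularPoint.logPotential_eq {ν : Measure ℂ} [IsProbabilityMeasure ν] {z : ℂ}
    (hz : IsRegularPoint ν z) (hν : HasLogMoment ν) :
    logPotential ν z = (realPotential ν z : EReal) := by
  have hi := hz.integrable hν
  have hlog : ∀ᵐ w ∂ν, ENNReal.log ‖z - w‖ₑ = (Real.log ‖z - w‖ : EReal) := by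
    filter_upwards [hz.ae_ne] with w hw
    rw [← ofReal_norm, ENNReal.log_ofReal_of_pos (norm_pos_iff.2 (sub_ne_zero.2 hw.symm))]
  have h1 : ∫⁻ w, (ENNReal.log ‖z - w‖ₑ).toENNReal ∂ν =
      ∫⁻ w, ENNReal.ofReal (Real.log ‖z - w‖) ∂ν := by
    refine lintegral_congr_ae ?_
    filter_upwards [hlog] with w hw
    rw [hw, EReal.toENNReal_of_ne_top (EReal.coe_ne_top _), EReal.toReal_coe]
  have h2 : ∫⁻ w, (-ENNReal.log ‖z - w‖ₑ).toENNReal ∂ν =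
      ∫⁻ w, ENNReal.ofReal (-Real.log ‖z - w‖) ∂ν := by
    refine lintegral_congr_ae ?_
    filter_upwards [hlog] with w hw
    rw [hw, ← EReal.coe_neg, EReal.toENNReal_of_ne_top (EReal.coe_ne_top _), EReal.toReal_coe]
  rw [logPotential, h1, h2, realPotential, integral_eq_lintegral_pos_part_sub_lintegral_neg_part hi]
  have f1 : ∫⁻ w, ENNReal.ofReal (Real.log ‖z - w‖) ∂ν ≠ ∞ :=
    ((lintegral_mono fun w => ENNReal.ofReal_le_ofReal (le_abs_self _)).trans_lt
      (by simpa [hasFiniteIntegral_iff_norm] using hi.hasFiniteIntegral)).ne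
  have f2 : ∫⁻ w, ENNReal.ofReal (-Real.log ‖z - w‖) ∂ν ≠ ∞ :=
    ((lintegral_mono fun w => ENNReal.ofReal_le_ofReal (neg_le_abs _)).trans_lt
      (by simpa [hasFiniteIntegral_iff_norm] using hi.hasFiniteIntegral)).ne
  rw [EReal.coe_sub, EReal.coe_ennreal_toReal f1, EReal.coe_ennreal_toReal f2]

theorem measurable_realPotential (ν : Measure ℂ) [SFinite ν] : Measurable (realPotential ν) :=
  (StronglyMeasurable.integral_prod_right' (f := fun p : ℂ × ℂ => Real.log ‖p.1 - p.2‖)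
    (Measurable.stronglyMeasurable (by fun_prop))).measurable

/-- Potentials are bounded in `L²` on discs by the logarithmic moment. -/
theorem lintegral_realPotential_sq_le (ν : Measure ℂ) [IsProbabilityMeasure ν] (R : ℝ) :
    ∫⁻ z in Metric.closedBall (0 : ℂ) R, ‖realPotential ν z‖ₑ ^ 2 ≤
      4 * (singularMass + (ENNReal.ofReal (Real.log 2 + Real.posLog R) +
        ∫⁻ w, ‖Real.posLog ‖w‖‖ₑ ∂ν) ^ 2 * volume (Metric.closedBall (0 : ℂ) R)) := by
  set T := ENNReal.ofReal (Real.log 2 + Real.posLog R) + ∫⁻ w, ‖Real.posLog ‖w‖‖ₑ ∂ν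
  calc ∫⁻ z in Metric.closedBall (0 : ℂ) R, ‖realPotential ν z‖ₑ ^ 2
      ≤ ∫⁻ z in Metric.closedBall (0 : ℂ) R, 4 * (singularPotential ν z ^ 2 + T ^ 2) := by
        refine setLIntegral_mono' Metric.isClosed_closedBall.measurableSet fun z hz => ?_
        refine le_trans ?_ (ennreal_add_sq_le _ _)
        gcongr
        exact (enorm_integral_le_lintegral_enorm _).trans
          (lintegral_enorm_log_norm_sub_le ν z (by simpa using hz))
    _ = 4 * ((∫⁻ z in Metric.closedBall (0 : ℂ) R, singularPotential ν z ^ 2) +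
          T ^ 2 * volume (Metric.closedBall (0 : ℂ) R)) := by
        rw [lintegral_const_mul' _ _ (by norm_num), lintegral_add_right _ measurable_const]
        simp
    _ ≤ _ := by
        gcongr
        exact (setLIntegral_le_lintegral _ _).trans (lintegral_singularPotential_sq_le ν)

theorem memLp_realPotential {ν : Measure ℂ} [IsProbabilityMeasure ν] (hν : HasLogMoment ν)
    (R : ℝ) : MemLp (realPotential ν) 2 (volume.restrict (Metric.closedBall (0 : ℂ) R)) := by
  refine ⟨(measurable_realPotential ν).aestronglyMeasurable, ?_⟩
  have h := lintegral_realPotential_sq_le ν R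
  have h1 : ∫⁻ w, ‖Real.posLog ‖w‖‖ₑ ∂ν < ∞ := hν.hasFiniteIntegral
  have h2 : ∫⁻ z in Metric.closedBall (0 : ℂ) R, ‖realPotential ν z‖ₑ ^ 2 < ∞ := by
    refine h.trans_lt (ENNReal.mul_lt_top (by norm_num) (ENNReal.add_lt_top.2
      ⟨singularMass_ne_top.lt_top, ENNReal.mul_lt_top (ENNReal.pow_lt_top
        (ENNReal.add_lt_top.2 ⟨ENNReal.ofReal_lt_top, h1⟩)) ?_⟩))
    exact measure_closedBall_lt_top
  have h3 := eLpNorm_nnreal_pow_eq_lintegral (f := realPotential ν)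
    (μ := volume.restrict (Metric.closedBall (0 : ℂ) R)) (p := 2) (by norm_num)
  simp only [NNReal.coe_ofNat, ENNReal.coe_ofNat, ENNReal.rpow_ofNat] at h3
  rw [← h3] at h2
  exact lt_top_iff_ne_top.2 fun h4 => by simp [h4] at h2

/-- `(2π)⁻¹ Δ U_ν = ν` in the sense of distributions. -/
theorem integral_eq_integral_realPotential_smul_laplacian {ν : Measure ℂ} [IsProbabilityMeasure ν]
    (hν : HasLogMoment ν) {φ : ℂ → ℂ} (hφ : ContDiff ℝ 2 φ) (hc : HasCompactSupport φ) :
    ∫ z, φ z ∂ν = (2 * Real.pi)⁻¹ • ∫ z, realPotential ν z • (Δ φ) z := by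
  have hcΔ := hasCompactSupport_laplacian hφ hc
  have hΔ := continuous_laplacian hφ
  obtain ⟨C, hC⟩ := hcΔ.exists_bound_of_continuous hΔ
  obtain ⟨R, hR⟩ := hcΔ.isCompact.isBounded.subset_closedBall (0 : ℂ)
  have hC0 : 0 ≤ C := (norm_nonneg _).trans (hC 0)
  let B := Metric.closedBall (0 : ℂ) R
  have hmeas : AEStronglyMeasurable (fun p : ℂ × ℂ => Real.log ‖p.2 - p.1‖ • (Δ φ) p.2)
      (ν.prod volume) := by
    refine Measurable.aestronglyMeasurable ?_
    have := hΔ.measurable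
    fun_prop
  have hint : Integrable (fun p : ℂ × ℂ => Real.log ‖p.2 - p.1‖ • (Δ φ) p.2)
      (ν.prod volume) := by
    refine ⟨hmeas, ?_⟩
    rw [hasFiniteIntegral_iff_enorm, lintegral_prod_symm' _ (by
      have := hΔ.measurable
      fun_prop)]
    have hbound : ∀ z : ℂ, ∫⁻ w, ‖Real.log ‖z - w‖ • (Δ φ) z‖ₑ ∂ν ≤
        B.indicator (fun z => (singularPotential ν z ^ 2 + (1 +
          (ENNReal.ofReal (Real.log 2 + Real.posLog R) + ∫⁻ w, ‖Real.posLog ‖w‖‖ₑ ∂ν))) *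
            ENNReal.ofReal C) z := by
      intro z
      by_cases hz : z ∈ B
      · rw [Set.indicator_of_mem hz]
        simp_rw [enorm_smul]
        rw [lintegral_mul_const _ (by fun_prop)]
        refine mul_le_mul' ?_ ?_
        · refine (lintegral_enorm_log_norm_sub_le ν z (R := R) (by simpa [B] using hz)).trans ?_
          rw [← add_assoc (singularPotential ν z ^ 2)]
          gcongr
          -- The bound `s ≤ s ^ 2 + 1` makes the uniform `L²` estimate available for the joint
          -- integrability needed by Fubini.
          rcases le_total (singularPotential ν z) 1 with h | h
          · exact h.trans le_add_self
          · exact (le_self_pow₀ h two_ne_zero).trans le_self_add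
        · rw [← ofReal_norm]
          exact ENNReal.ofReal_le_ofReal (hC z)
      · have : (Δ φ) z = 0 := image_eq_zero_of_notMem_tsupport fun h => hz (hR h)
        simp [this]
    refine (lintegral_mono hbound).trans_lt ?_
    rw [lintegral_indicator Metric.isClosed_closedBall.measurableSet,
      lintegral_mul_const' _ _ ENNReal.ofReal_ne_top, lintegral_add_right _ measurable_const]
    have h1 : ∫⁻ w, ‖Real.posLog ‖w‖‖ₑ ∂ν < ∞ := hν.hasFiniteIntegral
    refine ENNReal.mul_lt_top (ENNReal.add_lt_top.2 ⟨?_, ?_⟩) ENNReal.ofReal_lt_top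
    · exact ((setLIntegral_le_lintegral _ _).trans
        (lintegral_singularPotential_sq_le ν)).trans_lt singularMass_ne_top.lt_top
    · rw [lintegral_const]
      refine ENNReal.mul_lt_top ?_ (by
        rw [Measure.restrict_apply_univ]; exact measure_closedBall_lt_top)
      exact ENNReal.add_lt_top.2 ⟨ENNReal.one_lt_top,
        ENNReal.add_lt_top.2 ⟨ENNReal.ofReal_lt_top, h1⟩⟩
  have hswap : ∫ w, ∫ z, Real.log ‖z - w‖ • (Δ φ) z ∂volume ∂ν =
      ∫ z, ∫ w, Real.log ‖z - w‖ • (Δ φ) z ∂ν ∂volume := integral_integral_swap hint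
  simp_rw [integral_log_norm_sub_smul_laplacian hφ hc, integral_smul_const] at hswap
  rw [integral_smul] at hswap
  change _ = ∫ z, realPotential ν z • (Δ φ) z at hswap
  rw [← hswap, smul_smul, inv_mul_cancel₀ (by positivity), one_smul]

theorem locallyIntegrable_of_memLp_closedBall {g : ℂ → ℝ}
    (hg : ∀ R, MemLp g 2 (volume.restrict (Metric.closedBall (0 : ℂ) R))) :
    LocallyIntegrable g volume := by
  refine locallyIntegrable_iff.2 fun K hK => ?_
  obtain ⟨R, hR⟩ := hK.isBounded.subset_closedBall (0 : ℂ)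
  have : IsFiniteMeasure (volume.restrict (Metric.closedBall (0 : ℂ) R)) :=
    ⟨by rw [Measure.restrict_apply_univ]; exact measure_closedBall_lt_top⟩
  exact IntegrableOn.mono_set ((hg R).integrable (by norm_num)) hR

/-! ### The maximum of the scaled potentials -/

section MaxPotential

variable {m : ℕ} {μ : Fin m → Measure ℂ} [∀ k, IsProbabilityMeasure (μ k)]

/-- At a regular point all potentials are real, so the convention for `c = 0` agrees with real
multiplication and the supremum of finitely many values is attained. -/
theorem exists_maxPotential_eq (hm : 0 < m) (hlog : ∀ k, HasLogMoment (μ k)) (c : Fin m → ℝ)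
    {z : ℂ} (hz : ∀ k, IsRegularPoint (μ k) z) :
    ∃ k, maxPotential c μ z = ((c k * realPotential (μ k) z : ℝ) : EReal) ∧
      ∀ j, c j * realPotential (μ j) z ≤ c k * realPotential (μ k) z := by
  have : Nonempty (Fin m) := ⟨⟨0, hm⟩⟩
  have hs (k : Fin m) : scaledPotential (c k) (μ k) z =
      ((c k * realPotential (μ k) z : ℝ) : EReal) := by
    unfold scaledPotential
    split_ifs with h
    · simp [h]
    · rw [(hz k).logPotential_eq (hlog k), EReal.coe_mul]
  obtain ⟨k, hk⟩ := Finite.exists_max fun k => c k * realPotential (μ k) z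
  refine ⟨k, le_antisymm (iSup_le fun j => ?_) ?_, hk⟩
  · rw [hs]; exact EReal.coe_le_coe_iff.2 (hk j)
  · rw [← hs]; exact le_iSup (fun j => scaledPotential (c j) (μ j) z) k

theorem ae_forall_isRegularPoint : ∀ᵐ z : ℂ, ∀ k, IsRegularPoint (μ k) z :=
  ae_all_iff.2 fun k => ae_isRegularPoint (μ k)

theorem aemeasurable_maxPotential_toReal (hm : 0 < m) (hlog : ∀ k, HasLogMoment (μ k))
    (c : Fin m → ℝ) : AEMeasurable (fun z => (maxPotential c μ z).toReal) volume := by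
  have : Nonempty (Fin m) := ⟨⟨0, hm⟩⟩
  refine ⟨fun z => ⨆ k, c k * realPotential (μ k) z,
    Measurable.iSup fun k => (measurable_realPotential (μ k)).const_mul (c k), ?_⟩
  filter_upwards [ae_forall_isRegularPoint (μ := μ)] with z hz
  obtain ⟨k, hk, hmax⟩ := exists_maxPotential_eq hm hlog c hz
  rw [hk, EReal.toReal_coe]
  exact le_antisymm (le_ciSup (f := fun k => c k * realPotential (μ k) z)
    (Set.finite_range _).bddAbove k) (ciSup_le hmax)

theorem memLp_maxPotential_toReal (hm : 0 < m) (hlog : ∀ k, HasLogMoment (μ k)) (c : Fin m → ℝ)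
    (R : ℝ) : MemLp (fun z => (maxPotential c μ z).toReal) 2
      (volume.restrict (Metric.closedBall (0 : ℂ) R)) := by
  have h : MemLp (fun z => ∑ k, ‖c k * realPotential (μ k) z‖) 2
      (volume.restrict (Metric.closedBall (0 : ℂ) R)) :=
    memLp_finsetSum _ fun k _ => ((memLp_realPotential (hlog k) R).const_mul (c k)).norm
  refine h.mono' (aemeasurable_maxPotential_toReal hm hlog c).restrict.aestronglyMeasurable ?_
  filter_upwards [ae_restrict_of_ae (ae_forall_isRegularPoint (μ := μ))] with z hz
  obtain ⟨k, hk, -⟩ := exists_maxPotential_eq hm hlog c hz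
  rw [hk, EReal.toReal_coe]
  exact Finset.single_le_sum (f := fun k => ‖c k * realPotential (μ k) z‖)
    (fun j _ => norm_nonneg _) (Finset.mem_univ k)

theorem ae_maxPotential_finite (hm : 0 < m) (hlog : ∀ k, HasLogMoment (μ k)) (c : Fin m → ℝ) :
    ∀ᵐ z : ℂ ∂volume, maxPotential c μ z ≠ ⊥ ∧ maxPotential c μ z ≠ ⊤ := by
  filter_upwards [ae_forall_isRegularPoint (μ := μ)] with z hz
  obtain ⟨k, hk, -⟩ := exists_maxPotential_eq hm hlog c hz
  rw [hk]
  exact ⟨EReal.coe_ne_bot _, EReal.coe_ne_top _⟩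

theorem locallyIntegrable_maxPotential_toReal (hm : 0 < m) (hlog : ∀ k, HasLogMoment (μ k))
    (c : Fin m → ℝ) : LocallyIntegrable (fun z => (maxPotential c μ z).toReal) volume :=
  locallyIntegrable_of_memLp_closedBall (memLp_maxPotential_toReal hm hlog c)

end MaxPotential

/-! ### Anti-concentration of sums of `log |z - X|` -/

section Concentration

/-- `exp (-x² / 2)` is the characteristic function of the standard Gaussian; exchange the two
integrals. -/
theorem integral_exp_neg_sq_eq_integral_charFun (ν : Measure ℝ) [IsProbabilityMeasure ν] :
    ((∫ x, Real.exp (-(x ^ 2 / 2)) ∂ν : ℝ) : ℂ) = ∫ t, charFun ν t ∂(gaussianReal 0 1) := by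
  have h1 (x : ℝ) : ((Real.exp (-(x ^ 2 / 2)) : ℝ) : ℂ) =
      ∫ t : ℝ, Complex.exp (x * t * Complex.I) ∂(gaussianReal 0 1) := by
    rw [← charFun_apply_real, charFun_gaussianReal]
    push_cast
    congr 1
    simp
  simp_rw [charFun_apply_real]
  rw [← integral_complex_ofReal]
  simp_rw [h1]
  rw [integral_integral_swap]
  · simp_rw [mul_comm]
  · refine Integrable.of_bound (C := 1) (Continuous.aestronglyMeasurable (by
      simp only [Function.uncurry_def]; fun_prop)) ?_
    refine ae_of_all _ fun p => ?_
    have : (p.1 : ℂ) * p.2 * Complex.I = ((p.1 * p.2 : ℝ) : ℂ) * Complex.I := by push_cast; ring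
    simp only [Function.uncurry_def]
    rw [this, Complex.norm_exp_ofReal_mul_I]

/-- A smoothing bound for the concentration of `Y` near an independent random centre. -/
theorem measureReal_abs_sub_le_one_le {Ω : Type*} [MeasurableSpace Ω] {P : Measure Ω}
    [IsProbabilityMeasure P] {Y G : Ω → ℝ} (hY : Measurable Y) (hG : Measurable G)
    (hYG : IndepFun Y G P) :
    P.real {ω | |Y ω - G ω| ≤ 1} ≤
      Real.exp 2⁻¹ * ∫ t, ‖charFun (P.map Y) t‖ ∂(gaussianReal 0 1) := by
  have hD : Measurable fun ω => Y ω - G ω := hY.sub hG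
  have : IsProbabilityMeasure (P.map fun ω => Y ω - G ω) :=
    Measure.isProbabilityMeasure_map hD.aemeasurable
  have : IsProbabilityMeasure (P.map Y) := Measure.isProbabilityMeasure_map hY.aemeasurable
  have : IsProbabilityMeasure (P.map (-G)) :=
    Measure.isProbabilityMeasure_map hG.neg.aemeasurable
  have hint : Integrable (fun ω => Real.exp (-((Y ω - G ω) ^ 2 / 2))) P := by
    refine Integrable.of_bound (C := 1) (Measurable.aestronglyMeasurable (by fun_prop)) ?_
    refine ae_of_all _ fun ω => ?_
    rw [Real.norm_of_nonneg (Real.exp_nonneg _), Real.exp_le_one_iff]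
    nlinarith [sq_nonneg (Y ω - G ω)]
  have hset : MeasurableSet {ω | |Y ω - G ω| ≤ 1} :=
    measurableSet_le (continuous_abs.measurable.comp hD) measurable_const
  -- The indicator of `[-1, 1]` is at most `exp (1/2) * exp (-y² / 2)`, which is the origin of the
  -- constant.
  have h1 : P.real {ω | |Y ω - G ω| ≤ 1} ≤
      Real.exp 2⁻¹ * ∫ ω, Real.exp (-((Y ω - G ω) ^ 2 / 2)) ∂P := by
    rw [← integral_indicator_one hset, ← integral_const_mul]
    refine integral_mono ((integrable_const (1 : ℝ)).indicator hset) (hint.const_mul _) fun ω => ?_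
    by_cases h : ω ∈ {ω | |Y ω - G ω| ≤ 1}
    · rw [Set.indicator_of_mem h, Pi.one_apply, ← Real.exp_add, Real.one_le_exp_iff]
      have : (Y ω - G ω) ^ 2 ≤ 1 := (sq_le_one_iff_abs_le_one _).2 h
      linarith
    · rw [Set.indicator_of_notMem h]
      positivity
  refine h1.trans (mul_le_mul_of_nonneg_left ?_ (Real.exp_nonneg _))
  have h2 : ∫ ω, Real.exp (-((Y ω - G ω) ^ 2 / 2)) ∂P =
      ∫ x, Real.exp (-(x ^ 2 / 2)) ∂(P.map fun ω => Y ω - G ω) := by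
    rw [integral_map hD.aemeasurable (Measurable.aestronglyMeasurable (by fun_prop))]
  have h3 := integral_exp_neg_sq_eq_integral_charFun (P.map fun ω => Y ω - G ω)
  have h4 : ‖∫ t, charFun (P.map fun ω => Y ω - G ω) t ∂(gaussianReal 0 1)‖ ≤
      ∫ t, ‖charFun (P.map Y) t‖ ∂(gaussianReal 0 1) := by
    refine norm_integral_le_of_norm_le ?_ (ae_of_all _ fun t => ?_)
    · refine Integrable.of_bound (C := 1) measurable_charFun.norm.aestronglyMeasurable ?_
      refine ae_of_all _ fun t => ?_
      simpa using norm_charFun_le_one (μ := P.map Y) t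
    -- By independence the characteristic function factors, and the factor of the arbitrary centre
    -- has modulus at most `1`.
    · have hind : IndepFun Y (-G) P := hYG.comp measurable_id measurable_neg
      have h5 := hind.charFun_map_add_eq_mul hY.aemeasurable hG.neg.aemeasurable
      have h6 : (fun ω => Y ω - G ω) = Y + -G := by ext ω; simp [sub_eq_add_neg]
      rw [h6, h5, Pi.mul_apply, norm_mul]
      exact mul_le_of_le_one_right (norm_nonneg _) (norm_charFun_le_one t)
  rw [h2]
  rw [← h3, Complex.norm_real] at h4
  exact (le_abs_self _).trans h4

theorem eq_dirac_of_ae_eq {μ : Measure ℂ} [IsProbabilityMeasure μ] {a : ℂ}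
    (h : ∀ᵐ x ∂μ, x = a) : μ = Measure.dirac a := by
  have h1 : μ.map id = μ.map fun _ => a := Measure.map_congr h
  rw [Measure.map_id, Measure.map_const] at h1
  simpa using h1

/-- The exceptional points form the perpendicular bisector, a proper affine subspace. -/
theorem ae_norm_sub_ne {x y : ℂ} (hxy : x ≠ y) : ∀ᵐ z : ℂ, ‖z - x‖ ≠ ‖z - y‖ := by
  have h : volume (AffineSubspace.perpBisector x y : Set ℂ) = 0 :=
    Measure.addHaar_affineSubspace volume _ fun h => by simp [hxy] at h
  rw [ae_iff]
  convert h using 2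
  ext z
  simp [AffineSubspace.mem_perpBisector_iff_dist_eq, dist_eq_norm]

/-- The exceptional `t` lie in `(2π / v) ℤ`, which is countable, and the Gaussian has no atoms. -/
theorem ae_exp_mul_I_ne_one {v : ℝ} (hv : v ≠ 0) :
    ∀ᵐ t ∂(gaussianReal 0 1), Complex.exp ((t * v : ℝ) * Complex.I) ≠ 1 := by
  have : NullSingletonClass (gaussianReal 0 1) :=
    nullSingletonClass_gaussianReal one_ne_zero
  rw [ae_iff]
  refine Set.Countable.measure_zero ?_ _
  refine (Set.countable_range fun k : ℤ => (k : ℝ) * (2 * Real.pi) / v).mono fun t ht => ?_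
  simp only [not_not, Set.mem_ofPred_eq, Complex.exp_eq_one_iff] at ht
  obtain ⟨k, hk⟩ := ht
  refine ⟨k, ?_⟩
  have h2 : ((t * v : ℝ) : ℂ) = ((k * (2 * Real.pi) : ℝ) : ℂ) := by
    apply mul_right_cancel₀ Complex.I_ne_zero
    rw [hk]; push_cast; ring
  have h3 : t * v = k * (2 * Real.pi) := by exact_mod_cast h2
  simp only
  rw [← h3]; field_simp

/-- For a non-degenerate law, the characteristic function of `log |z - X|` has modulus `< 1` almost
everywhere, for almost every `z`. -/
theorem NonDegenerate.ae_norm_charFun_lt_one {μ : Measure ℂ} [IsProbabilityMeasure μ]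
    (hμ : NonDegenerate μ) : ∀ᵐ z : ℂ, ∀ᵐ t ∂(gaussianReal 0 1),
      ‖charFun (μ.map fun x => Real.log ‖z - x‖) t‖ < 1 := by
  -- `F` is the quotient of the unimodular integrands at two independent points. For distinct points
  -- it differs from `1` at almost every `(z, t)`, and Fubini exchanges the quantifiers.
  let F : (ℂ × ℝ) → (ℂ × ℂ) → ℂ := fun p q =>
    Complex.exp ((p.2 * (Real.log ‖p.1 - q.1‖ - Real.log ‖p.1 - q.2‖) : ℝ) * Complex.I)
  have hFm : Measurable (Function.uncurry F) := by
    simp only [F, Function.uncurry_def]; fun_prop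
  have hbase : ∀ q : ℂ × ℂ, q.1 ≠ q.2 →
      ∀ᵐ p ∂((volume : Measure ℂ).prod (gaussianReal 0 1)), F p q ≠ 1 := by
    intro q hq
    rw [Measure.ae_prod_iff_ae_ae]
    · have h1 : ∀ᵐ z : ℂ, z ≠ q.1 := by simp [ae_iff]
      have h2 : ∀ᵐ z : ℂ, z ≠ q.2 := by simp [ae_iff]
      filter_upwards [ae_norm_sub_ne hq, h1, h2] with z hz hz1 hz2
      have hp1 : 0 < ‖z - q.1‖ := norm_pos_iff.2 (sub_ne_zero.2 hz1)
      have hp2 : 0 < ‖z - q.2‖ := norm_pos_iff.2 (sub_ne_zero.2 hz2)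
      have hv : Real.log ‖z - q.1‖ - Real.log ‖z - q.2‖ ≠ 0 := fun h =>
        hz (Real.log_injOn_pos hp1 hp2 (sub_eq_zero.1 h))
      filter_upwards [ae_exp_mul_I_ne_one hv] with t ht
      exact ht
    · exact (measurableSet_eq_fun (hFm.comp measurable_prodMk_right) measurable_const).compl
  have hall : ∀ᵐ p ∂((volume : Measure ℂ).prod (gaussianReal 0 1)), ∀ᵐ q ∂(μ.prod μ),
      q.1 ≠ q.2 → F p q ≠ 1 := by
    rw [Measure.ae_ae_comm]
    · exact ae_of_all _ fun q => by
        by_cases hq : q.1 = q.2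
        · simp [hq]
        · simpa [hq] using hbase q hq
    · have hA : MeasurableSet {x : (ℂ × ℝ) × (ℂ × ℂ) | x.2.1 = x.2.2} :=
        measurableSet_eq_fun (by fun_prop) (by fun_prop)
      have hB : MeasurableSet {x : (ℂ × ℝ) × (ℂ × ℂ) | F x.1 x.2 = 1} :=
        measurableSet_eq_fun hFm measurable_const
      convert hA.union hB.compl using 1
      ext x
      simp only [Set.mem_ofPred_eq, Set.mem_union, Set.mem_compl_iff]
      tauto
  filter_upwards [Measure.ae_ae_of_ae_prod hall] with z hz
  filter_upwards [hz] with t ht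
  have hmz : Measurable fun x => Real.log ‖z - x‖ := by fun_prop
  rw [charFun_apply_real, integral_map hmz.aemeasurable
    (Continuous.aestronglyMeasurable (by fun_prop))]
  let f : ℂ → ℂ := fun x => Complex.exp (t * (Real.log ‖z - x‖ : ℝ) * Complex.I)
  have hfn (x : ℂ) : ‖f x‖ = 1 := by
    have : f x = Complex.exp ((t * Real.log ‖z - x‖ : ℝ) * Complex.I) := by
      simp only [f]; push_cast; rfl
    rw [this, Complex.norm_exp_ofReal_mul_I]
  -- A unimodular function whose mean has modulus `1` is almost everywhere constant. Then `F = 1` on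
  -- almost every pair, so two independent points coincide almost surely and `μ` is a point mass.
  rcases ae_eq_const_or_norm_integral_lt_of_norm_le_const (μ := μ) (f := f) (C := 1)
    (ae_of_all _ fun x => (hfn x).le) with h | h
  · exfalso
    set a := ⨍ x, f x ∂μ
    have h1 : ∀ᵐ x ∂μ, f x = a := h
    have h2 : ∀ᵐ q ∂(μ.prod μ), f q.1 = a ∧ f q.2 = a :=
      (Measure.quasiMeasurePreserving_fst.ae h1).and (Measure.quasiMeasurePreserving_snd.ae h1)
    have h3 : ∀ᵐ q ∂(μ.prod μ), q.1 = q.2 := by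
      filter_upwards [h2, ht] with q hq hqt
      by_contra hne
      refine hqt hne ?_
      have : F (z, t) q = f q.1 / f q.2 := by
        simp only [F, f]
        rw [← Complex.exp_sub]
        congr 1
        push_cast; ring
      rw [this, hq.1, hq.2]
      refine div_self fun ha => ?_
      have := hfn q.1
      rw [hq.1, ha] at this
      simp at this
    obtain ⟨x, hx⟩ := (Measure.ae_ae_of_ae_prod h3).exists
    exact hμ x (eq_dirac_of_ae_eq (hx.mono fun y hy => hy.symm))
  · simpa [f] using h

theorem tendsto_integral_norm_pow_zero {α : Type*} [MeasurableSpace α] {γ : Measure α}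
    [IsFiniteMeasure γ] {χ : α → ℂ} (hχ : Measurable χ) (h : ∀ᵐ t ∂γ, ‖χ t‖ < 1) :
    Tendsto (fun N : ℕ => ∫ t, ‖χ t‖ ^ N ∂γ) atTop (𝓝 0) := by
  have h0 : (0 : ℝ) = ∫ _, (0 : ℝ) ∂γ := by simp
  rw [h0]
  refine tendsto_integral_of_dominated_convergence (fun _ => 1)
    (fun N => (hχ.norm.pow_const N).aestronglyMeasurable) (integrable_const 1) ?_ ?_
  · intro N
    filter_upwards [h] with t ht
    rw [Real.norm_of_nonneg (by positivity)]
    exact pow_le_one₀ (norm_nonneg _) ht.le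
  · filter_upwards [h] with t ht
    exact tendsto_pow_atTop_nhds_zero_of_lt_one (norm_nonneg _) ht

end Concentration

/-! ### The law of large numbers along the degree sequences -/

/-- If `c > 0` then `d n → ∞` and the limit is taken along `d`. If `c = 0`, `d` need not tend to
infinity, but the averages are bounded and `d n / n → 0`. The condition `s 0 = 0` handles indices
with `d n = 0`. -/
theorem tendsto_comp_div_of_tendsto_div {s : ℕ → ℝ} (hs0 : s 0 = 0) {u c : ℝ}
    (hs : Tendsto (fun N : ℕ => s N / N) atTop (𝓝 u)) {d : ℕ → ℕ}
    (hd : Tendsto (fun n : ℕ => (d n : ℝ) / n) atTop (𝓝 c)) :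
    Tendsto (fun n : ℕ => s (d n) / n) atTop (𝓝 (c * u)) := by
  have hrew (n : ℕ) : s (d n) / n = (d n : ℝ) / n * (s (d n) / d n) := by
    rcases Nat.eq_zero_or_pos (d n) with h | h
    · simp [h, hs0]
    · have : (d n : ℝ) ≠ 0 := by exact_mod_cast h.ne'
      field_simp
  simp_rw [hrew]
  by_cases hc : c = 0
  · subst hc
    rw [zero_mul]
    obtain ⟨A, hA⟩ := hs.bddAbove_range
    obtain ⟨B, hB⟩ := hs.bddBelow_range
    have hbdd : ∀ n, ‖s (d n) / d n‖ ≤ |A| + |B| := fun n => by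
      have h1 : s (d n) / d n ≤ A := hA ⟨d n, rfl⟩
      have h2 : B ≤ s (d n) / d n := hB ⟨d n, rfl⟩
      rw [Real.norm_eq_abs, abs_le]
      exact ⟨by linarith [neg_abs_le B, abs_nonneg A], by linarith [le_abs_self A, abs_nonneg B]⟩
    exact hd.zero_mul_isBoundedUnder_le ⟨_, eventually_map.2 (Eventually.of_forall hbdd)⟩
  · have hc0 : 0 < c := lt_of_le_of_ne (ge_of_tendsto' hd fun n => by positivity) (Ne.symm hc)
    have h1 : Tendsto (fun n : ℕ => (d n : ℝ) / n * n) atTop atTop :=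
      hd.pos_mul_atTop hc0 tendsto_natCast_atTop_atTop
    have h2 : Tendsto (fun n : ℕ => (d n : ℝ)) atTop atTop := by
      refine h1.congr' ?_
      filter_upwards [eventually_gt_atTop 0] with n hn
      have : (n : ℝ) ≠ 0 := by exact_mod_cast hn.ne'
      field_simp
    exact hd.mul (hs.comp (tendsto_natCast_atTop_iff.1 h2))

theorem tendsto_measure_zero_of_ae_eventually_notMem {Ω : Type*} [MeasurableSpace Ω]
    {P : Measure Ω} [IsFiniteMeasure P] {E : ℕ → Set Ω} (hE : ∀ n, MeasurableSet (E n))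
    (h : ∀ᵐ ω ∂P, ∀ᶠ n in atTop, ω ∉ E n) : Tendsto (fun n => P (E n)) atTop (𝓝 0) := by
  have := tendsto_measure_of_ae_tendsto_indicator_of_isFiniteMeasure (μ := P) (A := ∅) atTop
    MeasurableSet.empty hE (by
      filter_upwards [h] with ω hω
      filter_upwards [hω] with n hn
      simp [hn])
  simpa using this

/-- A family of independent random variables in which `X i k` has law `μ k`. -/
structure IsSample {Ω : Type*} [MeasurableSpace Ω] (P : Measure Ω) {m : ℕ}
    (μ : Fin m → Measure ℂ) (X : ℕ → Fin m → Ω → ℂ) : Prop where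
  measurable : ∀ i k, Measurable (X i k)
  indep : iIndepFun (fun ik : ℕ × Fin m => X ik.1 ik.2) P
  law : ∀ i k, P.map (X i k) = μ k

/-- The value at `z` of the monic polynomial whose roots are the first `N` variables of the
`k`-th family. -/
def rootProd {Ω : Type*} {m : ℕ} (X : ℕ → Fin m → Ω → ℂ) (z : ℂ) (k : Fin m) (N : ℕ) (ω : Ω) : ℂ :=
  ∏ i ∈ Finset.range N, (z - X i k ω)

set_option linter.unusedSectionVars false

namespace IsSample

variable {Ω : Type*} [MeasurableSpace Ω] {P : Measure Ω} [IsProbabilityMeasure P] {m : ℕ}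
  {μ : Fin m → Measure ℂ} [∀ k, IsProbabilityMeasure (μ k)] {X : ℕ → Fin m → Ω → ℂ}

theorem measurable_rootProd (hX : IsSample P μ X) (z : ℂ) (k : Fin m) (N : ℕ) :
    Measurable (rootProd X z k N) :=
  Finset.measurable_fun_prod _ fun i _ => measurable_const.sub (hX.measurable i k)

theorem ae_log_average_tendsto (hX : IsSample P μ X) {z : ℂ} {k : Fin m}
    (hint : Integrable (fun w => Real.log ‖z - w‖) (μ k)) :
    ∀ᵐ ω ∂P, Tendsto (fun N : ℕ => (∑ i ∈ Finset.range N, Real.log ‖z - X i k ω‖) / N) atTop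
      (𝓝 (realPotential (μ k) z)) := by
  have hg : Measurable fun w : ℂ => Real.log ‖z - w‖ := by fun_prop
  have hint0 : Integrable (fun ω => Real.log ‖z - X 0 k ω‖) P := by
    rw [← hX.law 0 k] at hint
    exact hint.comp_measurable (hX.measurable 0 k)
  have h := strong_law_ae_real (μ := P) (fun i ω => Real.log ‖z - X i k ω‖) hint0 ?_ ?_
  · have h2 : ∫ ω, Real.log ‖z - X 0 k ω‖ ∂P = realPotential (μ k) z := by
      rw [realPotential, ← hX.law 0 k, integral_map (hX.measurable 0 k).aemeasurable
        hg.aestronglyMeasurable]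
    rwa [h2] at h
  · intro i j hij
    have : (i, k) ≠ (j, k) := fun h => hij (congrArg Prod.fst h)
    exact (hX.indep.indepFun this).comp hg hg
  · intro i
    have : IdentDistrib (X i k) (X 0 k) P P :=
      ⟨(hX.measurable i k).aemeasurable, (hX.measurable 0 k).aemeasurable, by
        rw [hX.law, hX.law]⟩
    exact this.comp hg

theorem ae_forall_sub_ne_zero (hX : IsSample P μ X) {z : ℂ} {k : Fin m}
    (hz : IsRegularPoint (μ k) z) : ∀ᵐ ω ∂P, ∀ i, z - X i k ω ≠ 0 := by
  refine ae_all_iff.2 fun i => ?_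
  have h := hz.ae_ne
  rw [← hX.law i k] at h
  filter_upwards [ae_of_ae_map (hX.measurable i k).aemeasurable h] with ω hω
  exact sub_ne_zero.2 (Ne.symm hω)

theorem log_norm_rootProd {z : ℂ} {k : Fin m} {ω : Ω} (h : ∀ i, z - X i k ω ≠ 0) (N : ℕ) :
    Real.log ‖rootProd X z k N ω‖ = ∑ i ∈ Finset.range N, Real.log ‖z - X i k ω‖ := by
  rw [rootProd, norm_prod, Real.log_prod fun i _ => norm_ne_zero_iff.2 (h i)]

theorem rootProd_ne_zero {z : ℂ} {k : Fin m} {ω : Ω} (h : ∀ i, z - X i k ω ≠ 0) (N : ℕ) :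
    rootProd X z k N ω ≠ 0 := Finset.prod_ne_zero_iff.2 fun i _ => h i

theorem ae_log_norm_rootProd_tendsto (hX : IsSample P μ X) (hlog : ∀ k, HasLogMoment (μ k)) {z : ℂ}
    {k : Fin m} (hz : IsRegularPoint (μ k) z) {d : ℕ → ℕ} {c : ℝ}
    (hd : Tendsto (fun n : ℕ => (d n : ℝ) / n) atTop (𝓝 c)) :
    ∀ᵐ ω ∂P, (∀ i, z - X i k ω ≠ 0) ∧
      Tendsto (fun n : ℕ => Real.log ‖rootProd X z k (d n) ω‖ / n) atTop
        (𝓝 (c * realPotential (μ k) z)) := by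
  filter_upwards [hX.ae_log_average_tendsto (hz.integrable (hlog k)),
    hX.ae_forall_sub_ne_zero hz] with ω h1 h2
  refine ⟨h2, ?_⟩
  simp_rw [log_norm_rootProd h2]
  exact tendsto_comp_div_of_tendsto_div
    (s := fun N => ∑ i ∈ Finset.range N, Real.log ‖z - X i k ω‖) (by simp) h1 hd

theorem tendsto_measure_exp_lt_norm_rootProd (hX : IsSample P μ X)
    (hlog : ∀ k, HasLogMoment (μ k)) {z : ℂ} {k : Fin m} (hz : IsRegularPoint (μ k) z) {d : ℕ → ℕ}
    {c : ℝ} (hd : Tendsto (fun n : ℕ => (d n : ℝ) / n) atTop (𝓝 c)) {b : ℝ}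
    (hb : c * realPotential (μ k) z < b) :
    Tendsto (fun n : ℕ => P {ω | Real.exp (n * b) < ‖rootProd X z k (d n) ω‖}) atTop (𝓝 0) := by
  refine tendsto_measure_zero_of_ae_eventually_notMem
    (fun n => measurableSet_lt measurable_const (hX.measurable_rootProd z k _).norm) ?_
  filter_upwards [hX.ae_log_norm_rootProd_tendsto hlog hz hd] with ω ⟨h1, h2⟩
  filter_upwards [h2.eventually_lt_const hb, eventually_gt_atTop 0] with n hn hn0
  have hn0 : (0 : ℝ) < n := by exact_mod_cast hn0
  rw [div_lt_iff₀ hn0] at hn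
  have hpos : 0 < ‖rootProd X z k (d n) ω‖ := norm_pos_iff.2 (rootProd_ne_zero h1 _)
  simp only [not_lt]
  rw [← Real.log_le_iff_le_exp hpos]
  linarith

theorem tendsto_measure_norm_rootProd_lt_exp (hX : IsSample P μ X)
    (hlog : ∀ k, HasLogMoment (μ k)) {z : ℂ} {k : Fin m} (hz : IsRegularPoint (μ k) z) {d : ℕ → ℕ}
    {c : ℝ} (hd : Tendsto (fun n : ℕ => (d n : ℝ) / n) atTop (𝓝 c)) {b : ℝ}
    (hb : b < c * realPotential (μ k) z) :
    Tendsto (fun n : ℕ => P {ω | ‖rootProd X z k (d n) ω‖ < Real.exp (n * b)}) atTop (𝓝 0) := by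
  refine tendsto_measure_zero_of_ae_eventually_notMem
    (fun n => measurableSet_lt (hX.measurable_rootProd z k _).norm measurable_const) ?_
  filter_upwards [hX.ae_log_norm_rootProd_tendsto hlog hz hd] with ω ⟨h1, h2⟩
  filter_upwards [h2.eventually_const_lt hb, eventually_gt_atTop 0] with n hn hn0
  have hn0 : (0 : ℝ) < n := by exact_mod_cast hn0
  rw [lt_div_iff₀ hn0] at hn
  have hpos : 0 < ‖rootProd X z k (d n) ω‖ := norm_pos_iff.2 (rootProd_ne_zero h1 _)
  simp only [not_lt]
  rw [← Real.le_log_iff_exp_le hpos]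
  linarith

/-- Variables built from different families are independent. -/
theorem indepFun_of_family (hX : IsSample P μ X) (z : ℂ) (k : Fin m) (d : Fin m → ℕ) :
    IndepFun (fun ω => ∑ i ∈ Finset.range (d k), Real.log ‖z - X i k ω‖)
      (fun ω => Real.log ‖∑ j ∈ Finset.univ.erase k, rootProd X z j (d j) ω‖) P := by
  let σ : ℕ × Fin m → MeasurableSpace Ω := fun ik =>
    MeasurableSpace.comap (X ik.1 ik.2) inferInstance
  have hle : ∀ ik, σ ik ≤ ‹MeasurableSpace Ω› := fun ik => (hX.measurable ik.1 ik.2).comap_le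
  have hdisj : Disjoint {ik : ℕ × Fin m | ik.2 = k} {ik | ik.2 ≠ k} := by
    rw [Set.disjoint_left]; intro a ha hb; exact hb ha
  have hI := indep_iSup_of_disjoint hle hX.indep hdisj
  have hmeas (S : Set (ℕ × Fin m)) (ik : ℕ × Fin m) (h : ik ∈ S) :
      Measurable[⨆ i ∈ S, σ i] (X ik.1 ik.2) :=
    (comap_measurable (X ik.1 ik.2)).mono (le_iSup₂_of_le ik h le_rfl) le_rfl
  refine indep_of_indep_of_le_left (indep_of_indep_of_le_right hI ?_) ?_
  · refine Measurable.comap_le ?_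
    refine Real.measurable_log.comp (measurable_norm.comp ?_)
    refine Finset.measurable_fun_sum _ fun j hj => Finset.measurable_fun_prod _ fun i _ => ?_
    exact (measurable_const_sub z).comp (hmeas _ (i, j) (Finset.ne_of_mem_erase hj))
  · refine Measurable.comap_le ?_
    refine Finset.measurable_fun_sum _ fun i _ => ?_
    refine Real.measurable_log.comp (measurable_norm.comp ?_)
    exact (measurable_const_sub z).comp (hmeas _ (i, k) rfl)

theorem charFun_map_sum_log (hX : IsSample P μ X) (z : ℂ) (k : Fin m) (N : ℕ) (t : ℝ) :
    charFun (P.map fun ω => ∑ i ∈ Finset.range N, Real.log ‖z - X i k ω‖) t =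
      charFun ((μ k).map fun x => Real.log ‖z - x‖) t ^ N := by
  have hg : Measurable fun w : ℂ => Real.log ‖z - w‖ := by fun_prop
  have hinj : Function.Injective fun i : Finset.range N => ((i : ℕ), k) := fun a b h =>
    Subtype.ext (congrArg Prod.fst h)
  have h := iIndepFun.charFun_map_fun_finsetSum_eq_prod (P := P) (s := Finset.range N)
    (X := fun i ω => Real.log ‖z - X i k ω‖)
    (fun i _ => (hg.comp (hX.measurable i k)).aemeasurable)
    ((hX.indep.precomp hinj).comp (fun _ w => Real.log ‖z - w‖) fun _ => hg)
  rw [h, Finset.prod_apply]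
  have h2 (i : ℕ) : P.map (fun ω => Real.log ‖z - X i k ω‖) =
      (μ k).map fun x => Real.log ‖z - x‖ := by
    rw [← hX.law i k, Measure.map_map hg (hX.measurable i k)]
    rfl
  simp [h2]

end IsSample

/-! ### Excluding cancellation: pointwise convergence in probability -/

/-- Cancellation forces comparable sizes: `‖p + w‖ ≤ ‖p‖ / 2` makes the two moduli agree up to a
factor `2`, which is below `e`. -/
theorem abs_log_norm_sub_log_norm_le_one {p w : ℂ} {t s : ℝ} (ht : t ≤ s / 2)
    (hs : 0 < s) (hsum : ‖p + w‖ ≤ t) (hp : s ≤ ‖p‖) :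
    |Real.log ‖p‖ - Real.log ‖w‖| ≤ 1 := by
  have h1 : ‖p‖ ≤ ‖p + w‖ + ‖w‖ := by
    simpa using norm_sub_le (p + w) w
  have h2 : ‖w‖ ≤ ‖p + w‖ + ‖p‖ := by
    simpa using norm_sub_le (p + w) p
  have hp0 : 0 < ‖p‖ := hs.trans_le hp
  have hw0 : 0 < ‖w‖ := by linarith
  have he : (2 : ℝ) ≤ Real.exp 1 := by linarith [Real.add_one_le_exp (1 : ℝ)]
  rw [abs_sub_le_iff]
  constructor
  · have : Real.log ‖p‖ ≤ Real.log (Real.exp 1 * ‖w‖) :=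
      Real.log_le_log hp0 (by nlinarith)
    rw [Real.log_mul (Real.exp_ne_zero _) hw0.ne', Real.log_exp] at this
    linarith
  · have : Real.log ‖w‖ ≤ Real.log (Real.exp 1 * ‖p‖) :=
      Real.log_le_log hw0 (by nlinarith)
    rw [Real.log_mul (Real.exp_ne_zero _) hp0.ne', Real.log_exp] at this
    linarith

theorem tendsto_exp_natCast_mul_zero {b : ℝ} (hb : b < 0) :
    Tendsto (fun n : ℕ => Real.exp (n * b)) atTop (𝓝 0) :=
  Real.tendsto_exp_atBot.comp
    ((tendsto_natCast_atTop_atTop (R := ℝ)).atTop_mul_const_of_neg hb)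

theorem tendsto_finsetSum_zero {ι : Type*} {s : Finset ι} {f : ι → ℕ → ℝ≥0∞}
    (h : ∀ i ∈ s, Tendsto (f i) atTop (𝓝 0)) :
    Tendsto (fun n => ∑ i ∈ s, f i n) atTop (𝓝 0) := by
  simpa using tendsto_finsetSum s h

namespace IsSample

variable {Ω : Type*} [MeasurableSpace Ω] {P : Measure Ω} [IsProbabilityMeasure P] {m : ℕ}
  {μ : Fin m → Measure ℂ} [∀ k, IsProbabilityMeasure (μ k)] {X : ℕ → Fin m → Ω → ℂ}

/-- The smoothed concentration function of `∑_{i < N} log |z - X i k|`. -/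
def concentration (μ : Measure ℂ) (z : ℂ) (N : ℕ) : ℝ :=
  Real.exp 2⁻¹ * ∫ t, ‖charFun (μ.map fun x => Real.log ‖z - x‖) t‖ ^ N ∂(gaussianReal 0 1)

theorem tendsto_concentration {μ : Measure ℂ} [IsProbabilityMeasure μ] {z : ℂ}
    (hz : ∀ᵐ t ∂(gaussianReal 0 1), ‖charFun (μ.map fun x => Real.log ‖z - x‖) t‖ < 1) :
    Tendsto (concentration μ z) atTop (𝓝 0) := by
  have hg : Measurable fun w : ℂ => Real.log ‖z - w‖ := by fun_prop
  have : IsProbabilityMeasure (μ.map fun x => Real.log ‖z - x‖) :=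
    Measure.isProbabilityMeasure_map hg.aemeasurable
  have h := (tendsto_integral_norm_pow_zero measurable_charFun hz).const_mul (Real.exp 2⁻¹)
  rw [mul_zero] at h
  exact h

/-- A small sum means that the `k`-th term is itself small or nearly cancels the others. In the
latter case its logarithm falls within `1` of an independent random centre. -/
theorem measure_norm_sum_le (hX : IsSample P μ X) {z : ℂ} (k : Fin m)
    (hz : IsRegularPoint (μ k) z) (d : Fin m → ℕ) {t s : ℝ} (ht : t ≤ s / 2) (hs : 0 < s) :
    P {ω | ‖∑ j, rootProd X z j (d j) ω‖ ≤ t} ≤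
      P {ω | ‖rootProd X z k (d k) ω‖ < s} + ENNReal.ofReal (concentration (μ k) z (d k)) := by
  let Y : Ω → ℝ := fun ω => ∑ i ∈ Finset.range (d k), Real.log ‖z - X i k ω‖
  let G : Ω → ℝ := fun ω => Real.log ‖∑ j ∈ Finset.univ.erase k, rootProd X z j (d j) ω‖
  have hY : Measurable Y := Finset.measurable_fun_sum _ fun i _ =>
    (measurable_const.sub (hX.measurable i k)).norm.log
  have hG : Measurable G :=
    (Finset.measurable_fun_sum _ fun j _ => hX.measurable_rootProd z j (d j)).norm.log
  have hconc := measureReal_abs_sub_le_one_le hY hG (hX.indepFun_of_family z k d)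
  simp_rw [Y, hX.charFun_map_sum_log, norm_pow] at hconc
  have hsub : P {ω | ‖∑ j, rootProd X z j (d j) ω‖ ≤ t} ≤
      P ({ω | ‖rootProd X z k (d k) ω‖ < s} ∪ {ω | |Y ω - G ω| ≤ 1}) := by
    refine measure_mono_ae ?_
    filter_upwards [hX.ae_forall_sub_ne_zero hz] with ω hω
    intro h
    by_cases h1 : ‖rootProd X z k (d k) ω‖ < s
    · exact Or.inl h1
    · refine Or.inr ?_
      have h2 : ‖∑ j, rootProd X z j (d j) ω‖ ≤ t := h
      rw [← Finset.add_sum_erase _ _ (Finset.mem_univ k)] at h2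
      have h3 := abs_log_norm_sub_log_norm_le_one ht hs h2 (not_lt.1 h1)
      rw [log_norm_rootProd hω] at h3
      exact h3
  refine hsub.trans ((measure_union_le _ _).trans ?_)
  gcongr
  rw [← ofReal_measureReal]
  exact ENNReal.ofReal_le_ofReal hconc

/-- The degrees are frozen, so a single almost surely nonzero random variable is compared with
thresholds tending to `0`. -/
theorem tendsto_measure_norm_partialSum_le (hX : IsSample P μ X) {z : ℂ} {M : Finset (Fin m)}
    {δ : Fin m → ℕ} (hne : ∀ᵐ ω ∂P, ∑ k ∈ M, rootProd X z k (δ k) ω ≠ 0) {τ : ℕ → ℝ}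
    (hτ : Tendsto τ atTop (𝓝 0)) :
    Tendsto (fun n => P {ω | ‖∑ k ∈ M, rootProd X z k (δ k) ω‖ ≤ τ n}) atTop (𝓝 0) := by
  refine tendsto_measure_zero_of_ae_eventually_notMem (fun n => measurableSet_le
    (Finset.measurable_fun_sum _ fun j _ => hX.measurable_rootProd z j (δ j)).norm
    measurable_const) ?_
  filter_upwards [hne] with ω hω
  filter_upwards [hτ.eventually_lt_const (norm_pos_iff.2 hω)] with n hn
  simpa using hn

/-- The conditions on a point `z` under which `n⁻¹ log |P_n(z)|` converges in probability. -/
structure IsGoodPoint (P : Measure Ω) (μ : Fin m → Measure ℂ) (X : ℕ → Fin m → Ω → ℂ)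
    (z : ℂ) : Prop where
  regular : ∀ k, IsRegularPoint (μ k) z
  concentration : ∀ k, NonDegenerate (μ k) → Tendsto (concentration (μ k) z) atTop (𝓝 0)
  partialSum_ne_zero : ∀ M : Finset (Fin m), M.Nonempty → ∀ δ : Fin m → ℕ,
    ∀ᵐ ω ∂P, ∑ k ∈ M, rootProd X z k (δ k) ω ≠ 0

/-- For each `n` separately, since degrees may oscillate, either some term of maximal exponent has
degree at least `N₀` and anti-concentration applies, or all of them have degree below `N₀`. The
second case eventually forces `A = 0`; the other terms are then exponentially small and the maximal
part is one of finitely many fixed nonzero random variables. -/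
theorem tendsto_measure_norm_sum_le_exp (hX : IsSample P μ X) (hlog : ∀ k, HasLogMoment (μ k))
    {z : ℂ} (hz : IsGoodPoint P μ X z) {d : Fin m → ℕ → ℕ} {c : Fin m → ℝ}
    (hc : ∀ k, Tendsto (fun n : ℕ => (d k n : ℝ) / n) atTop (𝓝 (c k)))
    (hnondeg : ∀ k, ¬ BddAbove (Set.range (d k)) → NonDegenerate (μ k)) {A : ℝ} {k₀ : Fin m}
    (hk₀ : c k₀ * realPotential (μ k₀) z = A) (hmax : ∀ k, c k * realPotential (μ k) z ≤ A)
    {ε : ℝ} (hε : 0 < ε) :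
    Tendsto (fun n : ℕ => P {ω | ‖∑ k, rootProd X z k (d k n) ω‖ ≤ Real.exp (n * (A - ε))})
      atTop (𝓝 0) := by
  classical
  set a : Fin m → ℝ := fun k => c k * realPotential (μ k) z with ha
  let M : Finset (Fin m) := Finset.univ.filter fun k => a k = A
  have hM {k : Fin m} : k ∈ M ↔ a k = A := by simp [M]
  have hk₀M : k₀ ∈ M := hM.2 hk₀
  rw [ENNReal.tendsto_nhds_zero]
  intro η hη
  rcases eq_or_ne η ∞ with rfl | hη_top
  · exact Eventually.of_forall fun _ => le_top
  -- beyond `N₀` the concentration functions are small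
  have hNk (k : Fin m) : ∃ N, ∀ n, N ≤ d k n →
      ENNReal.ofReal (concentration (μ k) z (d k n)) ≤ η / 2 := by
    by_cases hb : BddAbove (Set.range (d k))
    · obtain ⟨B, hB⟩ := hb
      -- For bounded degrees the requirement is made vacuous, so non-degeneracy is not needed there.
      exact ⟨B + 1, fun n hn => absurd (hB ⟨n, rfl⟩) (by omega)⟩
    · have h1 := ENNReal.tendsto_ofReal (hz.concentration k (hnondeg k hb))
      rw [ENNReal.ofReal_zero, ENNReal.tendsto_nhds_zero] at h1
      obtain ⟨N, hN⟩ := eventually_atTop.1 (h1 (η / 2) (ENNReal.half_pos hη.ne'))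
      exact ⟨N, fun n hn => hN _ hn⟩
  choose N hN using hNk
  -- The added `1` makes `Fin N₀` inhabited.
  let N₀ := Finset.univ.sup N + 1
  have hN₀ (k : Fin m) : N k ≤ N₀ := (Finset.le_sup (Finset.mem_univ k)).trans (Nat.le_succ _)
  -- a gap between the maximal and the other exponents
  obtain ⟨g, hg0, hg⟩ : ∃ g > 0, ∀ k ∉ M, a k < A - g := by
    have hlt : ∀ k : Fin m, ∃ g > 0, k ∉ M → a k < A - g := fun k => by
      by_cases h : k ∈ M
      · exact ⟨1, one_pos, fun h' => absurd h h'⟩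
      · have : a k < A := lt_of_le_of_ne (hmax k) fun h' => h (hM.2 h')
        exact ⟨(A - a k) / 2, by linarith, fun _ => by linarith⟩
    choose g hg0 hg using hlt
    have hne : (Finset.univ : Finset (Fin m)).Nonempty := ⟨k₀, Finset.mem_univ _⟩
    refine ⟨Finset.univ.inf' hne g, (Finset.lt_inf'_iff _).2 fun k _ => hg0 k, fun k hk => ?_⟩
    linarith [hg k hk, Finset.inf'_le g (Finset.mem_univ k)]
  -- When `A = 0`, the maximal part is at most the whole sum, `exp (-nε)`, plus at most `m` other
  -- terms below `exp (-ng)`.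
  let τ : ℕ → ℝ := fun n => Real.exp (n * (-ε)) + m * Real.exp (n * (-g))
  have hτ : Tendsto τ atTop (𝓝 0) := by
    have h := (tendsto_exp_natCast_mul_zero (neg_lt_zero.2 hε)).add
      ((tendsto_exp_natCast_mul_zero (neg_lt_zero.2 hg0)).const_mul (m : ℝ))
    rw [mul_zero, add_zero] at h
    exact h
  have hLo : Tendsto (fun n : ℕ => ∑ k ∈ M,
      P {ω | ‖rootProd X z k (d k n) ω‖ < Real.exp (n * (A - ε / 2))}) atTop (𝓝 0) := by
    refine tendsto_finsetSum_zero fun k hk => ?_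
    refine hX.tendsto_measure_norm_rootProd_lt_exp hlog (hz.regular k) (hc k) ?_
    have : c k * realPotential (μ k) z = A := hM.1 hk
    linarith
  have hHi : Tendsto (fun n : ℕ => ∑ k ∈ Mᶜ,
      P {ω | Real.exp (n * (A - g)) < ‖rootProd X z k (d k n) ω‖}) atTop (𝓝 0) := by
    refine tendsto_finsetSum_zero fun k hk => ?_
    exact hX.tendsto_measure_exp_lt_norm_rootProd hlog (hz.regular k) (hc k)
      (hg k (Finset.mem_compl.1 hk))
  have hG : Tendsto (fun n : ℕ => ∑ δ : Fin m → Fin N₀,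
      P {ω | ‖∑ k ∈ M, rootProd X z k (δ k) ω‖ ≤ τ n}) atTop (𝓝 0) := by
    refine tendsto_finsetSum_zero fun δ _ => ?_
    exact hX.tendsto_measure_norm_partialSum_le (δ := fun k => (δ k : ℕ))
      (hz.partialSum_ne_zero M ⟨k₀, hk₀M⟩ _) hτ
  have hlarge : ∀ᶠ n : ℕ in atTop, ∀ k, c k ≠ 0 → N₀ ≤ d k n := by
    refine eventually_all.2 fun k => ?_
    by_cases hck : c k = 0
    · exact Eventually.of_forall fun n h => absurd hck h
    · have hs : Tendsto (fun n : ℕ => (n : ℝ) * ((d k n : ℝ) / n)) atTop atTop :=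
        tendsto_natCast_atTop_atTop.atTop_mul_pos
          (lt_of_le_of_ne (ge_of_tendsto' (hc k) fun n => by positivity) (Ne.symm hck)) (hc k)
      filter_upwards [hs.eventually_ge_atTop (N₀ : ℝ), eventually_gt_atTop 0] with n hn hn0 _
      have : (n : ℝ) ≠ 0 := by exact_mod_cast hn0.ne'
      rw [mul_div_cancel₀ _ this] at hn
      exact_mod_cast hn
  have hhalf : ∀ᶠ n : ℕ in atTop, Real.exp (n * (-(ε / 2))) ≤ 1 / 2 :=
    (tendsto_exp_natCast_mul_zero (by linarith)).eventually_le_const (by norm_num)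
  have hη2 : 0 < η / 2 := ENNReal.half_pos hη.ne'
  filter_upwards [ENNReal.tendsto_nhds_zero.1 hLo _ hη2, ENNReal.tendsto_nhds_zero.1 hHi _ hη2,
    ENNReal.tendsto_nhds_zero.1 hG _ hη2, hlarge, hhalf] with n hnLo hnHi hnG hnl hnh
  by_cases hcase : ∃ k ∈ M, N₀ ≤ d k n
  · obtain ⟨k, hk, hkd⟩ := hcase
    have h1 := hX.measure_norm_sum_le k (hz.regular k) (fun j => d j n)
      (t := Real.exp (n * (A - ε))) (s := Real.exp (n * (A - ε / 2))) (by
        have : (n : ℝ) * (A - ε) = n * (A - ε / 2) + n * (-(ε / 2)) := by ring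
        rw [this, Real.exp_add]
        nlinarith [Real.exp_pos (n * (A - ε / 2))]) (Real.exp_pos _)
    refine h1.trans ?_
    rw [← ENNReal.add_halves η]
    refine add_le_add (le_trans ?_ hnLo) (hN k n ((hN₀ k).trans hkd))
    exact Finset.single_le_sum
      (f := fun k => P {ω | ‖rootProd X z k (d k n) ω‖ < Real.exp (n * (A - ε / 2))})
      (fun _ _ => zero_le) hk
  · push Not at hcase
    -- A positive `c k₀` would make the degree of the `k₀`-th term exceed `N₀` for this `n`.
    have hA : A = 0 := by
      have h1 : c k₀ = 0 := by
        by_contra h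
        exact absurd (hnl k₀ h) (not_le.2 (hcase k₀ hk₀M))
      rw [← hk₀, h1, zero_mul]
    let δ : Fin m → Fin N₀ := fun k =>
      if h : d k n < N₀ then ⟨d k n, h⟩ else ⟨0, Nat.succ_pos _⟩
    have hδ (k : Fin m) (hk : k ∈ M) : (δ k : ℕ) = d k n := by simp [δ, hcase k hk]
    have hsub : {ω | ‖∑ k, rootProd X z k (d k n) ω‖ ≤ Real.exp (n * (A - ε))} ⊆
        (⋃ k ∈ Mᶜ, {ω | Real.exp (n * (A - g)) < ‖rootProd X z k (d k n) ω‖}) ∪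
          {ω | ‖∑ k ∈ M, rootProd X z k (δ k) ω‖ ≤ τ n} := by
      intro ω hω
      by_cases hhi : ∃ k ∈ Mᶜ, Real.exp (n * (A - g)) < ‖rootProd X z k (d k n) ω‖
      · obtain ⟨k, hk, h⟩ := hhi
        exact Or.inl (Set.mem_iUnion₂.2 ⟨k, hk, h⟩)
      · push Not at hhi
        refine Or.inr ?_
        have h1 : ∑ k ∈ M, rootProd X z k (δ k) ω = ∑ k ∈ M, rootProd X z k (d k n) ω :=
          Finset.sum_congr rfl fun k hk => by rw [hδ k hk]
        have h2 : ‖∑ k, rootProd X z k (d k n) ω‖ ≤ Real.exp (n * (A - ε)) := hω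
        have h3 : ‖∑ k ∈ Mᶜ, rootProd X z k (d k n) ω‖ ≤ m * Real.exp (n * (-g)) := by
          refine (norm_sum_le_of_le _ hhi).trans ?_
          rw [Finset.sum_const, nsmul_eq_mul, hA, zero_sub]
          gcongr
          exact_mod_cast (Finset.card_le_univ _).trans (by simp)
        have h4 : ∑ k ∈ M, rootProd X z k (d k n) ω = ∑ k, rootProd X z k (d k n) ω -
            ∑ k ∈ Mᶜ, rootProd X z k (d k n) ω :=
          eq_sub_of_add_eq (Finset.sum_add_sum_compl M _)
        change ‖∑ k ∈ M, rootProd X z k (δ k) ω‖ ≤ τ n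
        rw [h1, h4]
        rw [hA, zero_sub] at h2
        exact (norm_sub_le _ _).trans (add_le_add h2 h3)
    refine (measure_mono hsub).trans ((measure_union_le _ _).trans ?_)
    rw [← ENNReal.add_halves η]
    refine add_le_add ((measure_biUnion_finset_le _ _).trans hnHi) (le_trans ?_ hnG)
    exact Finset.single_le_sum
      (f := fun δ : Fin m → Fin N₀ => P {ω | ‖∑ k ∈ M, rootProd X z k (δ k) ω‖ ≤ τ n})
      (fun _ _ => zero_le) (Finset.mem_univ δ)

theorem tendsto_measure_exp_lt_norm_sum (hX : IsSample P μ X) (hlog : ∀ k, HasLogMoment (μ k))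
    {z : ℂ} (hz : ∀ k, IsRegularPoint (μ k) z) {d : Fin m → ℕ → ℕ} {c : Fin m → ℝ}
    (hc : ∀ k, Tendsto (fun n : ℕ => (d k n : ℝ) / n) atTop (𝓝 (c k))) {A : ℝ}
    (hmax : ∀ k, c k * realPotential (μ k) z ≤ A) {ε : ℝ} (hε : 0 < ε) :
    Tendsto (fun n : ℕ => P {ω | Real.exp (n * (A + ε)) < ‖∑ k, rootProd X z k (d k n) ω‖})
      atTop (𝓝 0) := by
  have hHi : Tendsto (fun n : ℕ => ∑ k,
      P {ω | Real.exp (n * (A + ε / 2)) < ‖rootProd X z k (d k n) ω‖}) atTop (𝓝 0) := by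
    refine tendsto_finsetSum_zero fun k _ => ?_
    exact hX.tendsto_measure_exp_lt_norm_rootProd hlog (hz k) (hc k) (by linarith [hmax k])
  have hm : ∀ᶠ n : ℕ in atTop, m * Real.exp (n * (-(ε / 2))) ≤ 1 := by
    have := (tendsto_exp_natCast_mul_zero (b := -(ε / 2)) (by linarith)).const_mul (m : ℝ)
    rw [mul_zero] at this
    exact this.eventually_le_const one_pos
  refine tendsto_of_tendsto_of_tendsto_of_le_of_le' tendsto_const_nhds hHi
    (Eventually.of_forall fun _ => zero_le) ?_
  filter_upwards [hm] with n hn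
  refine le_trans (measure_mono ?_) (measure_iUnion_fintype_le P
    fun k => {ω | Real.exp (n * (A + ε / 2)) < ‖rootProd X z k (d k n) ω‖})
  intro ω hω
  by_contra hcon
  simp only [Set.mem_iUnion, not_exists] at hcon
  have h1 : ‖∑ k, rootProd X z k (d k n) ω‖ ≤ ∑ _k : Fin m, Real.exp (n * (A + ε / 2)) :=
    norm_sum_le_of_le _ fun k _ => not_lt.1 (hcon k)
  have h2 : Real.exp (n * (A + ε)) < ‖∑ k, rootProd X z k (d k n) ω‖ := hω
  rw [Finset.sum_const, Finset.card_univ, Fintype.card_fin, nsmul_eq_mul] at h1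
  -- Half of `ε` is spent on absorbing the number `m` of summands.
  have h3 : (n : ℝ) * (A + ε / 2) = n * (A + ε) + n * (-(ε / 2)) := by ring
  rw [h3, Real.exp_add] at h1
  nlinarith [Real.exp_pos (n * (A + ε))]

/-- Pointwise convergence in probability of the normalised logarithm of the sum. -/
theorem tendsto_measure_log_norm_sum (hX : IsSample P μ X) (hlog : ∀ k, HasLogMoment (μ k))
    {z : ℂ} (hz : IsGoodPoint P μ X z) {d : Fin m → ℕ → ℕ} {c : Fin m → ℝ}
    (hc : ∀ k, Tendsto (fun n : ℕ => (d k n : ℝ) / n) atTop (𝓝 (c k)))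
    (hnondeg : ∀ k, ¬ BddAbove (Set.range (d k)) → NonDegenerate (μ k)) {A : ℝ} {k₀ : Fin m}
    (hk₀ : c k₀ * realPotential (μ k₀) z = A) (hmax : ∀ k, c k * realPotential (μ k) z ≤ A)
    {ε : ℝ} (hε : 0 < ε) :
    Tendsto (fun n : ℕ =>
      P {ω | ε ≤ |(n : ℝ)⁻¹ * Real.log ‖∑ k, rootProd X z k (d k n) ω‖ - A|}) atTop (𝓝 0) := by
  have h := (hX.tendsto_measure_exp_lt_norm_sum hlog hz.regular hc hmax (half_pos hε)).add
    (hX.tendsto_measure_norm_sum_le_exp hlog hz hc hnondeg hk₀ hmax (half_pos hε))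
  rw [add_zero] at h
  refine tendsto_of_tendsto_of_tendsto_of_le_of_le' tendsto_const_nhds h
    (Eventually.of_forall fun _ => zero_le) ?_
  filter_upwards [eventually_gt_atTop 0] with n hn
  have hn : (0 : ℝ) < n := by exact_mod_cast hn
  refine le_trans (measure_mono ?_) (measure_union_le _ _)
  intro ω hω
  by_contra hcon
  simp only [Set.mem_union, not_or] at hcon
  obtain ⟨h1, h2⟩ := hcon
  have h1 : ‖∑ k, rootProd X z k (d k n) ω‖ ≤ Real.exp (n * (A + ε / 2)) := not_lt.1 h1
  have h2 : Real.exp (n * (A - ε / 2)) < ‖∑ k, rootProd X z k (d k n) ω‖ := not_le.1 h2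
  have hpos := (Real.exp_pos _).trans h2
  rw [← Real.log_le_iff_le_exp hpos] at h1
  rw [← Real.lt_log_iff_exp_lt hpos] at h2
  have h3 : ε ≤ |(n : ℝ)⁻¹ * Real.log ‖∑ k, rootProd X z k (d k n) ω‖ - A| := hω
  set L := Real.log ‖∑ k, rootProd X z k (d k n) ω‖
  have h4 : (n : ℝ)⁻¹ * L ≤ A + ε / 2 := by
    rw [inv_mul_le_iff₀ hn]; exact h1
  have h5 : A - ε / 2 < (n : ℝ)⁻¹ * L := by
    rw [lt_inv_mul_iff₀ hn]; exact h2
  have h6 : |(n : ℝ)⁻¹ * L - A| ≤ ε / 2 := abs_le.2 ⟨by linarith, by linarith⟩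
  linarith

end IsSample

/-! ### Degree, leading coefficient and roots of the sum -/

section Roots

theorem monic_rootPoly (x : ℕ → ℂ) (d : ℕ) : (rootPoly x d).Monic := monic_prod_X_sub_C _ _

theorem natDegree_rootPoly (x : ℕ → ℂ) (d : ℕ) : (rootPoly x d).natDegree = d := by
  simp [rootPoly, natDegree_finsetProd_X_sub_C_eq_card]

/-- Each monic summand of degree exactly `D` contributes `1`, so the top coefficient counts summands
and cannot cancel. -/
theorem coeff_sum_rootPoly {ι : Type*} (M : Finset ι) (x : ι → ℕ → ℂ) {δ : ι → ℕ} {D : ℕ}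
    (hD : ∀ k ∈ M, δ k ≤ D) :
    (∑ k ∈ M, rootPoly (x k) (δ k)).coeff D = ((M.filter fun k => δ k = D).card : ℂ) := by
  rw [finsetSum_coeff, Finset.card_filter]
  push_cast
  refine Finset.sum_congr rfl fun k hk => ?_
  split_ifs with h
  · have := (monic_rootPoly (x k) (δ k)).coeff_natDegree
    rw [natDegree_rootPoly] at this
    rw [← h, this]
  · exact coeff_eq_zero_of_natDegree_lt (by
      rw [natDegree_rootPoly]; exact lt_of_le_of_ne (hD k hk) h)

theorem sum_rootPoly_ne_zero {ι : Type*} {M : Finset ι} (hM : M.Nonempty) (x : ι → ℕ → ℂ)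
    (δ : ι → ℕ) : ∑ k ∈ M, rootPoly (x k) (δ k) ≠ 0 := by
  obtain ⟨k₀, hk₀, hmax⟩ := M.exists_max_image δ hM
  intro h
  have h1 := coeff_sum_rootPoly M x hmax
  rw [h, coeff_zero, eq_comm, Nat.cast_eq_zero, Finset.card_eq_zero] at h1
  have : k₀ ∈ M.filter fun k => δ k = δ k₀ := by simp [hk₀]
  simp [h1] at this

/-- The sum of monic polynomials of degree at most `n`, at least one of them of degree `n`. -/
theorem natDegree_sum_rootPoly {m n : ℕ} (x : Fin m → ℕ → ℂ) {δ : Fin m → ℕ}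
    (hle : ∀ k, δ k ≤ n) {k₀ : Fin m} (hk₀ : δ k₀ = n) :
    (∑ k, rootPoly (x k) (δ k)).natDegree = n ∧
      ∃ ℓ : ℕ, 1 ≤ ℓ ∧ ℓ ≤ m ∧ (∑ k, rootPoly (x k) (δ k)).leadingCoeff = ℓ := by
  have hcoeff := coeff_sum_rootPoly Finset.univ x (δ := δ) (D := n) fun k _ => hle k
  set ℓ := (Finset.univ.filter fun k => δ k = n).card
  have hℓ1 : 1 ≤ ℓ := Finset.card_pos.2 ⟨k₀, by simp [hk₀]⟩
  have hℓm : ℓ ≤ m := (Finset.card_le_univ _).trans (by simp)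
  have hdeg : (∑ k, rootPoly (x k) (δ k)).natDegree = n := by
    refine natDegree_eq_of_le_of_coeff_ne_zero ?_ ?_
    · exact natDegree_sum_le_of_forall_le _ _ fun k _ => by
        rw [natDegree_rootPoly]; exact hle k
    · rw [hcoeff]; exact_mod_cast (by omega : ℓ ≠ 0)
  refine ⟨hdeg, ℓ, hℓ1, hℓm, ?_⟩
  rw [leadingCoeff, hdeg, hcoeff]

theorem eval_rootPoly {Ω : Type*} {m : ℕ} (X : ℕ → Fin m → Ω → ℂ) (z : ℂ) (k : Fin m) (N : ℕ)
    (ω : Ω) : (rootPoly (fun i => X i k ω) N).eval z = rootProd X z k N ω := by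
  simp [rootPoly, rootProd, eval_prod]

theorem integrable_sum_dirac {E : Type*} [NormedAddCommGroup E] (s : Multiset ℂ) (f : ℂ → E) :
    Integrable f (s.map fun z => Measure.dirac z).sum := by
  induction s using Multiset.induction with
  | empty => simp
  | cons a s ih =>
    rw [Multiset.map_cons, Multiset.sum_cons]
    exact (integrable_dirac (by simp)).add_measure ih

theorem integral_sum_dirac {E : Type*} [NormedAddCommGroup E] [NormedSpace ℝ E] [CompleteSpace E]
    (s : Multiset ℂ) (f : ℂ → E) :
    ∫ z, f z ∂(s.map fun z => Measure.dirac z).sum = (s.map f).sum := by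
  induction s using Multiset.induction with
  | empty => simp
  | cons a s ih =>
    rw [Multiset.map_cons, Multiset.sum_cons, integral_add_measure (integrable_dirac (by simp))
      (integrable_sum_dirac s f), ih, Multiset.map_cons, Multiset.sum_cons, integral_dirac]

theorem sum_dirac_univ (s : Multiset ℂ) :
    (s.map fun z => Measure.dirac z).sum Set.univ = s.card := by
  induction s using Multiset.induction with
  | empty => simp
  | cons a s ih =>
    rw [Multiset.map_cons, Multiset.sum_cons, Measure.add_apply, ih, Multiset.card_cons]
    simp [add_comm]

theorem integral_empiricalRootMeasure {E : Type*} [NormedAddCommGroup E] [NormedSpace ℝ E]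
    [CompleteSpace E] (n : ℕ) (p : ℂ[X]) (f : ℂ → E) :
    ∫ z, f z ∂(empiricalRootMeasure n p) = (n : ℝ)⁻¹ • (p.roots.map f).sum := by
  rw [empiricalRootMeasure, integral_smul_measure, integral_sum_dirac]
  simp

theorem isProbabilityMeasure_empiricalRootMeasure {n : ℕ} (hn : 1 ≤ n) {p : ℂ[X]}
    (hp : p.natDegree = n) : IsProbabilityMeasure (empiricalRootMeasure n p) := by
  refine ⟨?_⟩
  rw [empiricalRootMeasure, Measure.smul_apply, sum_dirac_univ,
    IsAlgClosed.card_roots_eq_natDegree, hp, smul_eq_mul]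
  exact ENNReal.inv_mul_cancel (by exact_mod_cast (by omega : n ≠ 0)) (ENNReal.natCast_ne_top n)

theorem integrable_empiricalRootMeasure {E : Type*} [NormedAddCommGroup E] {n : ℕ} (hn : 1 ≤ n)
    (p : ℂ[X]) (f : ℂ → E) : Integrable f (empiricalRootMeasure n p) :=
  (integrable_sum_dirac _ f).smul_measure
    (ENNReal.inv_ne_top.2 (by exact_mod_cast (by omega : n ≠ 0)))

theorem log_norm_eval_eq {p : ℂ[X]} {z : ℂ} (hz : p.eval z ≠ 0) :
    Real.log ‖p.eval z‖ = Real.log ‖p.leadingCoeff‖ +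
      (p.roots.map fun r => Real.log ‖z - r‖).sum := by
  have hp : p ≠ 0 := fun h => hz (by simp [h])
  have h1 : p.eval z = p.leadingCoeff * (p.roots.map fun r => z - r).prod := by
    conv_lhs => rw [(IsAlgClosed.splits p).eq_prod_roots]
    rw [eval_mul, eval_C, eval_multiset_prod, Multiset.map_map]
    simp
  have h2 : ‖(p.roots.map fun r => z - r).prod‖ = (p.roots.map fun r => ‖z - r‖).prod := by
    exact (Multiset.prod_hom' p.roots (normHom : ℂ →*₀ ℝ) fun r => z - r).symm
  have h3 : ∀ x ∈ p.roots.map fun r => ‖z - r‖, x ≠ 0 := by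
    intro x hx
    obtain ⟨r, hr, rfl⟩ := Multiset.mem_map.1 hx
    rw [norm_ne_zero_iff, sub_ne_zero]
    rintro rfl
    exact hz ((mem_roots hp).1 hr)
  rw [h1, norm_mul, h2, Real.log_mul (norm_ne_zero_iff.2 (leadingCoeff_ne_zero.2 hp))
    (Multiset.prod_ne_zero fun h => h3 0 h rfl), Real.log_multiset_prod h3, Multiset.map_map]
  rfl

theorem ae_eval_ne_zero {p : ℂ[X]} (hp : p ≠ 0) : ∀ᵐ z : ℂ, p.eval z ≠ 0 := by
  rw [ae_iff]
  have : {z : ℂ | ¬ p.eval z ≠ 0} = p.rootSet ℂ := by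
    ext z; simp [mem_rootSet, hp]
  rw [this]
  exact (rootSet_finite p ℂ).measure_zero _

/-- Jensen's formula bounds the logarithmic moment of the roots by the maximum on the circle. -/
theorem sum_posLog_roots_le {p : ℂ[X]} (hlead : 1 ≤ ‖p.leadingCoeff‖) {B : ℝ} (hB : 0 ≤ B)
    (hbound : ∀ z : ℂ, ‖z‖ = 1 → ‖p.eval z‖ ≤ Real.exp B) :
    (p.roots.map fun r => Real.posLog ‖r‖).sum ≤ B := by
  have h := logMahlerMeasure_eq_log_leadingCoeff_add_sum_log_roots p
  have h1 : p.logMahlerMeasure ≤ B := by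
    rw [logMahlerMeasure_def]
    refine Real.circleAverage_mono_on_of_le_circle p.intervalIntegrable_mahlerMeasure
      fun z hz => ?_
    have hz1 : ‖z‖ = 1 := by simpa using hz
    rcases eq_or_ne (p.eval z) 0 with h0 | h0
    -- At a zero on the circle `Real.log 0 = 0`, which is why `0 ≤ B` is required.
    · simpa [h0] using hB
    · rw [Real.log_le_iff_le_exp (norm_pos_iff.2 h0)]
      exact hbound z hz1
  have h2 : 0 ≤ Real.log ‖p.leadingCoeff‖ := Real.log_nonneg hlead
  linarith

end Roots

/-! ### Almost every point is good; Jensen bound for the random polynomial -/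

namespace IsSample

variable {Ω : Type*} [MeasurableSpace Ω] {P : Measure Ω} [IsProbabilityMeasure P] {m : ℕ}
  {μ : Fin m → Measure ℂ} [∀ k, IsProbabilityMeasure (μ k)] {X : ℕ → Fin m → Ω → ℂ}

theorem measurable_uncurry_rootProd (hX : IsSample P μ X) (k : Fin m) (N : ℕ) :
    Measurable fun p : ℂ × Ω => rootProd X p.1 k N p.2 :=
  Finset.measurable_fun_prod _ fun i _ =>
    measurable_fst.sub ((hX.measurable i k).comp measurable_snd)

/-- For each outcome a partial sum is a nonzero polynomial in `z`, hence nonzero almost everywhere;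
Fubini exchanges `z` and the outcome. Only countably many pairs of an index set and a degree vector
occur. -/
theorem ae_isGoodPoint (hX : IsSample P μ X) : ∀ᵐ z : ℂ, IsGoodPoint P μ X z := by
  have h1 : ∀ᵐ z : ℂ, ∀ k, NonDegenerate (μ k) →
      Tendsto (concentration (μ k) z) atTop (𝓝 0) := by
    refine ae_all_iff.2 fun k => ?_
    by_cases hk : NonDegenerate (μ k)
    · filter_upwards [hk.ae_norm_charFun_lt_one] with z hz _
      exact tendsto_concentration hz
    · exact ae_of_all _ fun z h => absurd h hk
  have h2 : ∀ᵐ z : ℂ, ∀ M : Finset (Fin m), M.Nonempty → ∀ δ : Fin m → ℕ,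
      ∀ᵐ ω ∂P, ∑ k ∈ M, rootProd X z k (δ k) ω ≠ 0 := by
    refine ae_all_iff.2 fun M => ?_
    by_cases hM : M.Nonempty
    · simp only [hM, true_imp_iff]
      refine ae_all_iff.2 fun δ => ?_
      rw [Measure.ae_ae_comm]
      · refine ae_of_all _ fun ω => ?_
        filter_upwards [ae_eval_ne_zero
          (sum_rootPoly_ne_zero hM (fun k i => X i k ω) δ)] with z hz
        simpa [eval_finsetSum, eval_rootPoly] using hz
      · exact (measurableSet_eq_fun (Finset.measurable_fun_sum _ fun k _ =>
          hX.measurable_uncurry_rootProd k (δ k)) measurable_const).compl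
    · exact ae_of_all _ fun z h => absurd h hM
  filter_upwards [ae_forall_isRegularPoint (μ := μ), h1, h2] with z hz1 hz2 hz3
  exact ⟨hz1, hz2, hz3⟩

end IsSample

/-- The averaged logarithmic size of the first `n` variables of all families. -/
def logSize {Ω : Type*} {m : ℕ} (X : ℕ → Fin m → Ω → ℂ) (n : ℕ) (ω : Ω) : ℝ :=
  (n : ℝ)⁻¹ * ∑ k, ∑ i ∈ Finset.range n, Real.log (1 + ‖X i k ω‖)

theorem log_one_add_norm_nonneg (w : ℂ) : 0 ≤ Real.log (1 + ‖w‖) :=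
  Real.log_nonneg (by linarith [norm_nonneg w])

theorem logSize_nonneg {Ω : Type*} {m : ℕ} (X : ℕ → Fin m → Ω → ℂ) (n : ℕ) (ω : Ω) :
    0 ≤ logSize X n ω :=
  mul_nonneg (by positivity) (Finset.sum_nonneg fun _ _ => Finset.sum_nonneg fun _ _ =>
    log_one_add_norm_nonneg _)

/-- On the unit circle each factor is at most `1 + |X|`. Enlarging the product to `n` factors from
every family gives one bound for all `k`. -/
theorem norm_rootProd_le {Ω : Type*} {m n : ℕ} (X : ℕ → Fin m → Ω → ℂ) (hn : 1 ≤ n) {z : ℂ}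
    (hz : ‖z‖ = 1) (k : Fin m) {N : ℕ} (hN : N ≤ n) (ω : Ω) :
    ‖rootProd X z k N ω‖ ≤ Real.exp (n * logSize X n ω) := by
  have hn0 : (n : ℝ) ≠ 0 := by exact_mod_cast (by omega : n ≠ 0)
  have h1 : ‖rootProd X z k N ω‖ ≤
      Real.exp (∑ i ∈ Finset.range N, Real.log (1 + ‖X i k ω‖)) := by
    rw [rootProd, norm_prod, Real.exp_sum]
    refine Finset.prod_le_prod (fun _ _ => norm_nonneg _) fun i _ => ?_
    rw [Real.exp_log (by positivity), ← hz]
    exact norm_sub_le _ _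
  refine h1.trans (Real.exp_le_exp.2 ?_)
  rw [logSize, mul_inv_cancel_left₀ hn0]
  calc ∑ i ∈ Finset.range N, Real.log (1 + ‖X i k ω‖)
      ≤ ∑ i ∈ Finset.range n, Real.log (1 + ‖X i k ω‖) :=
        Finset.sum_le_sum_of_subset_of_nonneg (Finset.range_mono hN)
          fun _ _ _ => log_one_add_norm_nonneg _
    _ ≤ _ := Finset.single_le_sum
        (f := fun k => ∑ i ∈ Finset.range n, Real.log (1 + ‖X i k ω‖))
        (fun _ _ => Finset.sum_nonneg fun _ _ => log_one_add_norm_nonneg _) (Finset.mem_univ k)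

/-- Jensen's formula with the bound `m * exp (n * logSize)` on the unit circle; the leading
coefficient has modulus at least `1`. -/
theorem integral_posLog_empiricalRootMeasure_le {Ω : Type*} {m n : ℕ} (X : ℕ → Fin m → Ω → ℂ)
    {δ : Fin m → ℕ} (hn : 1 ≤ n) (hle : ∀ k, δ k ≤ n) {k₀ : Fin m} (hk₀ : δ k₀ = n) (ω : Ω) :
    ∫ w, Real.posLog ‖w‖ ∂(empiricalRootMeasure n (∑ k, rootPoly (fun i => X i k ω) (δ k))) ≤
      Real.log m + logSize X n ω := by
  obtain ⟨-, ℓ, hℓ1, hℓm, hlead⟩ := natDegree_sum_rootPoly (fun k i => X i k ω) hle hk₀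
  have hm : (1 : ℝ) ≤ m := by exact_mod_cast hℓ1.trans hℓm
  have hlogm : 0 ≤ Real.log m := Real.log_nonneg hm
  have hn0 : (1 : ℝ) ≤ n := by exact_mod_cast hn
  rw [integral_empiricalRootMeasure, smul_eq_mul, inv_mul_le_iff₀ (by linarith)]
  refine (sum_posLog_roots_le (B := Real.log m + n * logSize X n ω) ?_ ?_ ?_).trans ?_
  · rw [hlead, Complex.norm_natCast]; exact_mod_cast hℓ1
  · exact add_nonneg hlogm (mul_nonneg (by positivity) (logSize_nonneg X n ω))
  · intro z hz
    rw [eval_finsetSum, Real.exp_add, Real.exp_log (by linarith)]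
    refine (norm_sum_le_of_le (n := fun _ => Real.exp (n * logSize X n ω)) _
      fun k _ => ?_).trans_eq ?_
    · rw [eval_rootPoly]; exact norm_rootProd_le X hn hz k (hle k) ω
    · simp
  · nlinarith

/-- The constant `b` is `n⁻¹ log ℓ` for the leading coefficient `ℓ`; the roots give the potential.
-/
theorem ae_log_norm_sum_eq {Ω : Type*} {m n : ℕ} (X : ℕ → Fin m → Ω → ℂ)
    {δ : Fin m → ℕ} (hn : 1 ≤ n) (hle : ∀ k, δ k ≤ n) {k₀ : Fin m} (hk₀ : δ k₀ = n) (ω : Ω) :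
    ∃ b : ℝ, 0 ≤ b ∧ b ≤ Real.log m ∧ ∀ᵐ z : ℂ,
      (n : ℝ)⁻¹ * Real.log ‖∑ k, rootProd X z k (δ k) ω‖ = b +
        realPotential (empiricalRootMeasure n (∑ k, rootPoly (fun i => X i k ω) (δ k))) z := by
  obtain ⟨-, ℓ, hℓ1, hℓm, hlead⟩ := natDegree_sum_rootPoly (fun k i => X i k ω) hle hk₀
  have hℓ : (1 : ℝ) ≤ ℓ := by exact_mod_cast hℓ1
  have hm : (ℓ : ℝ) ≤ m := by exact_mod_cast hℓm
  have hlogℓ : 0 ≤ Real.log ℓ := Real.log_nonneg hℓ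
  have hn0 : (1 : ℝ) ≤ n := by exact_mod_cast hn
  refine ⟨(n : ℝ)⁻¹ * Real.log ℓ, by positivity, ?_, ?_⟩
  · exact (mul_le_of_le_one_left hlogℓ (inv_le_one_of_one_le₀ hn0)).trans
      (Real.log_le_log (by linarith) hm)
  · filter_upwards [ae_eval_ne_zero (sum_rootPoly_ne_zero ⟨k₀, Finset.mem_univ k₀⟩
      (fun k i => X i k ω) δ)] with z hz
    have h := log_norm_eval_eq hz
    rw [hlead, Complex.norm_natCast] at h
    rw [realPotential, integral_empiricalRootMeasure, smul_eq_mul, ← mul_add, ← h]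
    simp [eval_finsetSum, eval_rootPoly]

/-! ### From pointwise convergence in probability to `L¹` convergence -/

section IntegratedConvergence

variable {Ω Z : Type*} [MeasurableSpace Ω] [MeasurableSpace Z] {P : Measure Ω}
  [IsProbabilityMeasure P] {ν : Measure Z} [IsFiniteMeasure ν]

theorem tendsto_lintegral_min_of_tendsto_measure {g : ℕ → Ω → ℝ≥0∞} (hg : ∀ n, Measurable (g n))
    (h : ∀ ε : ℝ≥0∞, 0 < ε → Tendsto (fun n => P {ω | ε ≤ g n ω}) atTop (𝓝 0)) {M : ℝ≥0∞}
    (hM : M ≠ ∞) : Tendsto (fun n => ∫⁻ ω, min (g n ω) M ∂P) atTop (𝓝 0) := by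
  rw [ENNReal.tendsto_nhds_zero]
  intro κ hκ
  have hκ2 : 0 < κ / 2 := ENNReal.half_pos hκ.ne'
  have h1 : Tendsto (fun n => M * P {ω | κ / 2 ≤ g n ω}) atTop (𝓝 0) := by
    simpa using ENNReal.Tendsto.const_mul (h _ hκ2) (Or.inr hM)
  filter_upwards [ENNReal.tendsto_nhds_zero.1 h1 _ hκ2] with n hn
  have hset : MeasurableSet {ω | κ / 2 ≤ g n ω} := measurableSet_le measurable_const (hg n)
  calc ∫⁻ ω, min (g n ω) M ∂P
      ≤ ∫⁻ ω, (κ / 2 + {ω | κ / 2 ≤ g n ω}.indicator (fun _ => M) ω) ∂P := by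
        refine lintegral_mono fun ω => ?_
        by_cases hω : ω ∈ {ω | κ / 2 ≤ g n ω}
        · rw [Set.indicator_of_mem hω]
          exact (min_le_right _ _).trans le_add_self
        · rw [Set.indicator_of_notMem hω, add_zero]
          exact (min_le_left _ _).trans (not_le.1 hω).le
    _ = κ / 2 + M * P {ω | κ / 2 ≤ g n ω} := by
        rw [lintegral_add_left measurable_const, lintegral_indicator_const hset]
        simp
    _ ≤ κ / 2 + κ / 2 := by gcongr
    _ = κ := ENNReal.add_halves κ

/-- Convergence in probability at almost every point together with tightness of the `L²` norms
implies convergence in probability of the `L¹` norms. -/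
theorem tendsto_measure_le_lintegral {f : ℕ → Z → Ω → ℝ≥0∞}
    (hf : ∀ n, Measurable fun p : Z × Ω => f n p.1 p.2)
    (hpt : ∀ᵐ z ∂ν, ∀ ε : ℝ≥0∞, 0 < ε → Tendsto (fun n => P {ω | ε ≤ f n z ω}) atTop (𝓝 0))
    (hsq : ∀ η : ℝ≥0∞, 0 < η → ∃ C : ℝ≥0∞, C ≠ ∞ ∧
      ∀ᶠ n in atTop, P {ω | C < ∫⁻ z, f n z ω ^ 2 ∂ν} ≤ η)
    {ε : ℝ≥0∞} (hε : 0 < ε) (hε_top : ε ≠ ∞) :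
    Tendsto (fun n => P {ω | ε ≤ ∫⁻ z, f n z ω ∂ν}) atTop (𝓝 0) := by
  rw [ENNReal.tendsto_nhds_zero]
  intro η hη
  have hη2 : 0 < η / 2 := ENNReal.half_pos hη.ne'
  have hε2 : 0 < ε / 2 := ENNReal.half_pos hε.ne'
  have hε2_top : ε / 2 ≠ ∞ := ENNReal.div_ne_top hε_top (by norm_num)
  obtain ⟨C, hC, hCn⟩ := hsq _ hη2
  -- From `f ≤ min f M + f ^ 2 / M`, the choice of `M` makes the last term integrate to at most `ε /
  -- 2` whenever the squared norm is at most `C`.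
  let M : ℝ≥0∞ := C / (ε / 2) + 1
  have hM : M ≠ ∞ := ENNReal.add_ne_top.2 ⟨ENNReal.div_ne_top hC hε2.ne', ENNReal.one_ne_top⟩
  have hM0 : M ≠ 0 := by simp [M]
  have hCM : M⁻¹ * C ≤ ε / 2 := by
    rw [ENNReal.inv_mul_le_iff hM0 hM, mul_comm]
    calc C = C / (ε / 2) * (ε / 2) := (ENNReal.div_mul_cancel hε2.ne' hε2_top).symm
      _ ≤ M * (ε / 2) := by gcongr; exact le_self_add
      _ = _ := mul_comm _ _
  have hmin : Tendsto (fun n => ∫⁻ ω, ∫⁻ z, min (f n z ω) M ∂ν ∂P) atTop (𝓝 0) := by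
    have hswap (n : ℕ) : ∫⁻ ω, ∫⁻ z, min (f n z ω) M ∂ν ∂P =
        ∫⁻ z, ∫⁻ ω, min (f n z ω) M ∂P ∂ν :=
      (lintegral_lintegral_swap ((hf n).min measurable_const).aemeasurable).symm
    simp_rw [hswap]
    rw [← lintegral_zero (μ := ν)]
    refine tendsto_lintegral_of_dominated_convergence (fun _ => M) (fun n => ?_) (fun n => ?_)
      ?_ ?_
    · exact Measurable.lintegral_prod_right' (f := fun p : Z × Ω => min (f n p.1 p.2) M)
        ((hf n).min measurable_const)
    · refine ae_of_all _ fun z => ?_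
      exact (lintegral_mono fun ω => min_le_right _ _).trans_eq (by simp)
    · rw [lintegral_const]
      exact ENNReal.mul_ne_top hM (measure_ne_top _ _)
    · filter_upwards [hpt] with z hz
      exact tendsto_lintegral_min_of_tendsto_measure
        (fun n => (hf n).comp measurable_prodMk_left) hz hM
  have hmin2 : Tendsto (fun n => (∫⁻ ω, ∫⁻ z, min (f n z ω) M ∂ν ∂P) / (ε / 2)) atTop (𝓝 0) := by
    simpa using ENNReal.Tendsto.div_const hmin (Or.inr hε2.ne')
  filter_upwards [hCn, ENNReal.tendsto_nhds_zero.1 hmin2 _ hη2] with n hn1 hn2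
  have hsub : {ω | ε ≤ ∫⁻ z, f n z ω ∂ν} ⊆ {ω | C < ∫⁻ z, f n z ω ^ 2 ∂ν} ∪
      {ω | ε / 2 ≤ ∫⁻ z, min (f n z ω) M ∂ν} := by
    intro ω hω
    by_contra hcon
    simp only [Set.mem_union, not_or] at hcon
    obtain ⟨h1, h2⟩ := hcon
    have h1 : ∫⁻ z, f n z ω ^ 2 ∂ν ≤ C := not_lt.1 h1
    have h2 : ∫⁻ z, min (f n z ω) M ∂ν < ε / 2 := not_le.1 h2
    have hmeas : Measurable fun z => f n z ω := (hf n).comp measurable_prodMk_right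
    have h3 : ∫⁻ z, f n z ω ∂ν ≤
        ∫⁻ z, min (f n z ω) M ∂ν + M⁻¹ * ∫⁻ z, f n z ω ^ 2 ∂ν := by
      rw [← lintegral_const_mul _ (hmeas.pow_const 2),
        ← lintegral_add_left (hmeas.min measurable_const)]
      refine lintegral_mono fun z => ?_
      rcases le_total (f n z ω) M with h | h
      · simp only [min_eq_left h]; exact le_self_add
      · refine le_trans ?_ le_add_self
        calc f n z ω = M⁻¹ * (M * f n z ω) := by
              rw [← mul_assoc, ENNReal.inv_mul_cancel hM0 hM, one_mul]
          _ ≤ M⁻¹ * f n z ω ^ 2 := by rw [sq]; gcongr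
    have h4 : ∫⁻ z, f n z ω ∂ν < ε := by
      calc ∫⁻ z, f n z ω ∂ν ≤ ∫⁻ z, min (f n z ω) M ∂ν + M⁻¹ * C := by
            refine h3.trans ?_; gcongr
        _ ≤ ∫⁻ z, min (f n z ω) M ∂ν + ε / 2 := by gcongr
        _ < ε / 2 + ε / 2 := ENNReal.add_lt_add_right hε2_top h2
        _ = ε := ENNReal.add_halves ε
    exact absurd h4 (not_lt.2 hω)
  calc P {ω | ε ≤ ∫⁻ z, f n z ω ∂ν}
      ≤ P {ω | C < ∫⁻ z, f n z ω ^ 2 ∂ν} + P {ω | ε / 2 ≤ ∫⁻ z, min (f n z ω) M ∂ν} :=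
        (measure_mono hsub).trans (measure_union_le _ _)
    _ ≤ η / 2 + η / 2 := by
        refine add_le_add hn1 (le_trans ?_ hn2)
        exact meas_ge_le_lintegral_div (Measurable.aemeasurable
          (Measurable.lintegral_prod_left' (f := fun p : Z × Ω => min (f n p.1 p.2) M)
            ((hf n).min measurable_const))) hε2.ne' hε2_top
    _ = η := ENNReal.add_halves η

end IntegratedConvergence

/-! ### Smooth test functions, tightness and compactness -/

section WeakConvergence

open scoped ContDiff in
/-- Smooth compactly supported complex-valued functions on the plane. -/
abbrev SmoothTest : Type := {φ : ℂ → ℂ // ContDiff ℝ ∞ φ ∧ HasCompactSupport φ}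

theorem exists_boundedContinuous_eq (φ : SmoothTest) : ∃ g : ℂ →ᵇ ℂ, ∀ z, g z = φ.1 z := by
  obtain ⟨C, hC⟩ := φ.2.2.exists_bound_of_continuous φ.2.1.continuous
  exact ⟨BoundedContinuousFunction.ofNormedAddCommGroup φ.1 φ.2.1.continuous C hC, fun _ => rfl⟩

/-- Finite measures on the plane are determined by smooth compactly supported functions. -/
theorem measure_ext_of_smoothTest {ρ ρ' : Measure ℂ} [IsFiniteMeasure ρ] [IsFiniteMeasure ρ']
    (h : ∀ φ : SmoothTest, ∫ z, φ.1 z ∂ρ = ∫ z, φ.1 z ∂ρ') : ρ = ρ' := by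
  -- Both measures have densities with respect to their sum, and smooth tests identify locally
  -- integrable densities almost everywhere.
  have hac : ρ ≪ ρ + ρ' := Measure.absolutelyContinuous_of_le (Measure.le_add_right le_rfl)
  have hac' : ρ' ≪ ρ + ρ' := Measure.absolutelyContinuous_of_le (Measure.le_add_left le_rfl)
  have h1 : ∀ᵐ x ∂(ρ + ρ'), (ρ.rnDeriv (ρ + ρ') x).toReal = (ρ'.rnDeriv (ρ + ρ') x).toReal := by
    refine ae_eq_of_integral_contDiff_smul_eq Measure.integrable_toReal_rnDeriv.locallyIntegrable
      Measure.integrable_toReal_rnDeriv.locallyIntegrable fun g hg hgc => ?_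
    have h2 := h ⟨fun z => (g z : ℂ), Complex.ofRealCLM.contDiff.comp hg,
      hgc.comp_left Complex.ofReal_zero⟩
    simp only [integral_complex_ofReal] at h2
    have h3 : ∫ z, g z ∂ρ = ∫ z, g z ∂ρ' := by exact_mod_cast h2
    simp_rw [smul_eq_mul, mul_comm (g _), ← smul_eq_mul]
    rw [integral_rnDeriv_smul hac, integral_rnDeriv_smul hac', h3]
  have h4 : ρ.rnDeriv (ρ + ρ') =ᵐ[ρ + ρ'] ρ'.rnDeriv (ρ + ρ') := by
    filter_upwards [h1, ρ.rnDeriv_lt_top (ρ + ρ'), ρ'.rnDeriv_lt_top (ρ + ρ')] with x h1 h2 h3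
    exact (ENNReal.toReal_eq_toReal_iff' h2.ne h3.ne).1 h1
  calc ρ = (ρ + ρ').withDensity (ρ.rnDeriv (ρ + ρ')) :=
        (Measure.withDensity_rnDeriv_eq ρ (ρ + ρ') hac).symm
    _ = (ρ + ρ').withDensity (ρ'.rnDeriv (ρ + ρ')) := withDensity_congr_ae h4
    _ = ρ' := Measure.withDensity_rnDeriv_eq ρ' (ρ + ρ') hac'

/-- Probability measures with logarithmic moment at most `C`. -/
def logMomentLE (C : ℝ≥0∞) : Set (ProbabilityMeasure ℂ) :=
  {ν | ∫⁻ w, ‖Real.posLog ‖w‖‖ₑ ∂(ν : Measure ℂ) ≤ C}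

/-- Since `log₊ |w|` tends to infinity with `|w|`, Markov's inequality gives tightness, and
Prokhorov's theorem gives compactness. -/
theorem isCompact_closure_logMomentLE {C : ℝ≥0∞} (hC : C ≠ ∞) :
    IsCompact (closure (logMomentLE C)) := by
  refine isCompact_closure_of_isTightMeasureSet ?_
  rw [isTightMeasureSet_iff_exists_isCompact_measure_compl_le]
  intro ε hε
  have hlim : Tendsto (fun N : ℕ => C / (N : ℝ≥0∞)) atTop (𝓝 0) := by
    simpa using ENNReal.Tendsto.const_div ENNReal.tendsto_nat_nhds_top (Or.inr hC)
  obtain ⟨N, hN, hN0⟩ := ((ENNReal.tendsto_nhds_zero.1 hlim ε hε).and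
    (eventually_gt_atTop 0)).exists
  refine ⟨Metric.closedBall 0 (Real.exp N), isCompact_closedBall _ _, ?_⟩
  rintro _ ⟨ν, hν, rfl⟩
  refine le_trans ?_ hN
  have hsub : (Metric.closedBall (0 : ℂ) (Real.exp N))ᶜ ⊆
      {w | (N : ℝ≥0∞) ≤ ‖Real.posLog ‖w‖‖ₑ} := by
    intro w hw
    have hw' : Real.exp N < ‖w‖ := by simpa using hw
    have h1 : (N : ℝ) ≤ Real.posLog ‖w‖ := by
      rw [Real.posLog]
      exact le_max_of_le_right ((Real.le_log_iff_exp_le ((Real.exp_pos _).trans hw')).2 hw'.le)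
    change (N : ℝ≥0∞) ≤ ‖Real.posLog ‖w‖‖ₑ
    rw [Real.enorm_of_nonneg Real.posLog_nonneg, ← ENNReal.ofReal_natCast]
    exact ENNReal.ofReal_le_ofReal h1
  refine (measure_mono hsub).trans ?_
  refine (meas_ge_le_lintegral_div (Measurable.aemeasurable ?_) ?_
    (ENNReal.natCast_ne_top N)).trans ?_
  · exact (measurable_posLog.comp measurable_norm).enorm
  · exact_mod_cast hN0.ne'
  · gcongr
    exact hν

theorem continuous_integral_probabilityMeasure (g : ℂ →ᵇ ℂ) :
    Continuous fun ν : ProbabilityMeasure ℂ => ∫ z, g z ∂(ν : Measure ℂ) := by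
  refine continuous_iff_continuousAt.2 fun ν => ?_
  exact (ProbabilityMeasure.tendsto_iff_forall_integral_rclike_tendsto ℂ).1 tendsto_id g

/-- The measures that integrate `φ` to within `1 / (N + 1)` of `a`. -/
def nearSet (φ : SmoothTest) (a : ℂ) (N : ℕ) : Set (ProbabilityMeasure ℂ) :=
  {ν | ‖∫ z, φ.1 z ∂(ν : Measure ℂ) - a‖ ≤ 1 / ((N : ℝ) + 1)}

theorem isClosed_nearSet (φ : SmoothTest) (a : ℂ) (N : ℕ) : IsClosed (nearSet φ a N) := by
  obtain ⟨g, hg⟩ := exists_boundedContinuous_eq φ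
  have : nearSet φ a N =
      {ν : ProbabilityMeasure ℂ | ‖∫ z, g z ∂(ν : Measure ℂ) - a‖ ≤ 1 / ((N : ℝ) + 1)} := by
    simp_rw [nearSet, hg]
  rw [this]
  exact isClosed_le ((continuous_integral_probabilityMeasure g).sub continuous_const).norm
    continuous_const

theorem integral_eq_of_forall_mem_nearSet {φ : SmoothTest} {a : ℂ} {ν : ProbabilityMeasure ℂ}
    (h : ∀ N, ν ∈ nearSet φ a N) : ∫ z, φ.1 z ∂(ν : Measure ℂ) = a := by
  rw [← sub_eq_zero, ← norm_le_zero_iff]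
  exact ge_of_tendsto' tendsto_one_div_add_atTop_nhds_zero_nat h

theorem nearSet_antitone (φ : SmoothTest) (a : ℂ) : Antitone (nearSet φ a) := by
  intro N N' hN ν hν
  have hν : ‖∫ z, φ.1 z ∂(ν : Measure ℂ) - a‖ ≤ 1 / ((N' : ℝ) + 1) := hν
  exact hν.trans (one_div_le_one_div_of_le (by positivity) (by gcongr))

/-- A functional that is approximated on finite sets of test functions by probability measures with
bounded logarithmic moment is given by a probability measure. -/
theorem exists_probabilityMeasure_of_approx {L : SmoothTest → ℂ} {C : ℝ≥0∞} (hC : C ≠ ∞)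
    (h : ∀ (F : Finset SmoothTest) (N : ℕ), ∃ ν ∈ logMomentLE C, ∀ φ ∈ F, ν ∈ nearSet φ (L φ) N) :
    ∃ ρ : ProbabilityMeasure ℂ, ∀ φ : SmoothTest, ∫ z, φ.1 z ∂(ρ : Measure ℂ) = L φ := by
  classical
  -- The hypothesis is the finite intersection property for the closed sets `nearSet`; several
  -- tolerances are merged by taking the finest.
  obtain ⟨ρ, -, hρ⟩ := (isCompact_closure_logMomentLE hC).inter_iInter_nonempty
    (fun i : SmoothTest × ℕ => nearSet i.1 (L i.1) i.2) (fun i => isClosed_nearSet _ _ _) (by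
      intro u
      obtain ⟨ν, hν, hF⟩ := h (u.image Prod.fst) (u.sup Prod.snd)
      refine ⟨ν, subset_closure hν, Set.mem_iInter₂.2 fun i hi => ?_⟩
      exact nearSet_antitone _ _ (Finset.le_sup hi) (hF _ (Finset.mem_image_of_mem _ hi)))
  exact ⟨ρ, fun φ => integral_eq_of_forall_mem_nearSet fun N => Set.mem_iInter.1 hρ (φ, N)⟩

/-- On measures with bounded logarithmic moment, integrals of bounded continuous functions are
controlled by finitely many smooth test functions. -/
theorem exists_finset_control {C : ℝ≥0∞} (hC : C ≠ ∞) (ρ : ProbabilityMeasure ℂ) (g : ℂ →ᵇ ℂ)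
    {ε : ℝ} (hε : 0 < ε) :
    ∃ (F : Finset SmoothTest) (N : ℕ), ∀ ν ∈ logMomentLE C,
      (∀ φ ∈ F, ν ∈ nearSet φ (∫ z, φ.1 z ∂(ρ : Measure ℂ)) N) →
        ‖∫ z, g z ∂(ν : Measure ℂ) - ∫ z, g z ∂(ρ : Measure ℂ)‖ < ε := by
  classical
  -- `S` is the compact set of measures violating the conclusion. Only `ρ` lies in every `nearSet`
  -- and `ρ ∉ S`, so finitely many constraints already exclude `S`.
  let S : Set (ProbabilityMeasure ℂ) := closure (logMomentLE C) ∩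
    {ν | ε ≤ ‖∫ z, g z ∂(ν : Measure ℂ) - ∫ z, g z ∂(ρ : Measure ℂ)‖}
  have hS : IsCompact S := (isCompact_closure_logMomentLE hC).inter_right
    (isClosed_le continuous_const
      ((continuous_integral_probabilityMeasure g).sub continuous_const).norm)
  obtain ⟨u, hu⟩ := hS.elim_finite_subfamily_closed
    (fun i : SmoothTest × ℕ => nearSet i.1 (∫ z, i.1.1 z ∂(ρ : Measure ℂ)) i.2)
    (fun i => isClosed_nearSet _ _ _) (by
      rw [Set.eq_empty_iff_forall_notMem]
      rintro ν ⟨⟨-, hν⟩, hνI⟩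
      have h1 : (ν : Measure ℂ) = ρ := measure_ext_of_smoothTest fun φ =>
        integral_eq_of_forall_mem_nearSet fun N => Set.mem_iInter.1 hνI (φ, N)
      have h2 : ε ≤ ‖∫ z, g z ∂(ν : Measure ℂ) - ∫ z, g z ∂(ρ : Measure ℂ)‖ := hν
      rw [h1, sub_self, norm_zero] at h2
      linarith)
  refine ⟨u.image Prod.fst, u.sup Prod.snd, fun ν hν hF => ?_⟩
  by_contra hcon
  have : ν ∈ S ∩ ⋂ i ∈ u, nearSet i.1 (∫ z, i.1.1 z ∂(ρ : Measure ℂ)) i.2 :=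
    ⟨⟨subset_closure hν, not_lt.1 hcon⟩, Set.mem_iInter₂.2 fun i hi =>
      nearSet_antitone _ _ (Finset.le_sup hi) (hF _ (Finset.mem_image_of_mem _ hi))⟩
  rw [hu] at this
  exact this

end WeakConvergence

/-! ### Moment and `L²` bounds for the random root measures -/

theorem lintegral_log_one_add_norm_lt_top {ν : Measure ℂ} [IsProbabilityMeasure ν]
    (hν : HasLogMoment ν) : ∫⁻ w, ENNReal.ofReal (Real.log (1 + ‖w‖)) ∂ν < ∞ := by
  have h : ∀ w : ℂ, ENNReal.ofReal (Real.log (1 + ‖w‖)) ≤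
      ENNReal.ofReal (Real.log 2) + ‖Real.posLog ‖w‖‖ₑ := fun w => by
    rw [Real.enorm_of_nonneg Real.posLog_nonneg,
      ← ENNReal.ofReal_add (Real.log_nonneg (by norm_num)) Real.posLog_nonneg]
    refine ENNReal.ofReal_le_ofReal ?_
    have h1 := Real.posLog_add (x := 1) (y := ‖w‖)
    have h2 : Real.log (1 + ‖w‖) ≤ Real.posLog (1 + ‖w‖) := le_max_right _ _
    have h3 : Real.posLog 1 = 0 := by simp [Real.posLog]
    linarith
  refine (lintegral_mono h).trans_lt ?_
  rw [lintegral_add_left measurable_const]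
  have h1 : ∫⁻ w, ‖Real.posLog ‖w‖‖ₑ ∂ν < ∞ := hν.hasFiniteIntegral
  exact ENNReal.add_lt_top.2 ⟨by simp, h1⟩

theorem lintegral_empiricalRootMeasure_posLog_le {Ω : Type*} {m n : ℕ} (X : ℕ → Fin m → Ω → ℂ)
    {δ : Fin m → ℕ} (hn : 1 ≤ n) (hle : ∀ k, δ k ≤ n) {k₀ : Fin m} (hk₀ : δ k₀ = n) (ω : Ω) :
    ∫⁻ w, ‖Real.posLog ‖w‖‖ₑ
        ∂(empiricalRootMeasure n (∑ k, rootPoly (fun i => X i k ω) (δ k))) ≤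
      ENNReal.ofReal (Real.log m + logSize X n ω) := by
  have h := ofReal_integral_eq_lintegral_ofReal
    (integrable_empiricalRootMeasure hn (∑ k, rootPoly (fun i => X i k ω) (δ k))
      fun w => Real.posLog ‖w‖) (ae_of_all _ fun w => Real.posLog_nonneg)
  simp_rw [Real.enorm_of_nonneg Real.posLog_nonneg]
  rw [← h]
  exact ENNReal.ofReal_le_ofReal (integral_posLog_empiricalRootMeasure_le X hn hle hk₀ ω)

/-- The `L²` norm of the normalised logarithm of the sum on a disc is controlled by `logSize`. -/
theorem lintegral_log_norm_sum_sq_le {Ω : Type*} {m n : ℕ} (X : ℕ → Fin m → Ω → ℂ)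
    {δ : Fin m → ℕ} (hn : 1 ≤ n) (hle : ∀ k, δ k ≤ n) {k₀ : Fin m} (hk₀ : δ k₀ = n) (ω : Ω)
    (R : ℝ) :
    ∫⁻ z in Metric.closedBall (0 : ℂ) R,
        ‖(n : ℝ)⁻¹ * Real.log ‖∑ k, rootProd X z k (δ k) ω‖‖ₑ ^ 2 ≤
      4 * (ENNReal.ofReal (Real.log m) ^ 2 * volume (Metric.closedBall (0 : ℂ) R) +
        4 * (singularMass + (ENNReal.ofReal (Real.log 2 + Real.posLog R) +
          ENNReal.ofReal (Real.log m + logSize X n ω)) ^ 2 *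
            volume (Metric.closedBall (0 : ℂ) R))) := by
  obtain ⟨b, hb0, hbm, hb⟩ := ae_log_norm_sum_eq X hn hle hk₀ ω
  set ρ := empiricalRootMeasure n (∑ k, rootPoly (fun i => X i k ω) (δ k))
  have : IsProbabilityMeasure ρ := isProbabilityMeasure_empiricalRootMeasure hn
    (natDegree_sum_rootPoly (fun k i => X i k ω) hle hk₀).1
  calc ∫⁻ z in Metric.closedBall (0 : ℂ) R,
        ‖(n : ℝ)⁻¹ * Real.log ‖∑ k, rootProd X z k (δ k) ω‖‖ₑ ^ 2
      ≤ ∫⁻ z in Metric.closedBall (0 : ℂ) R,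
        4 * (ENNReal.ofReal (Real.log m) ^ 2 + ‖realPotential ρ z‖ₑ ^ 2) := by
        refine lintegral_mono_ae ?_
        filter_upwards [ae_restrict_of_ae hb] with z hz
        rw [hz]
        refine le_trans ?_ (ennreal_add_sq_le _ _)
        gcongr
        refine (enorm_add_le _ _).trans ?_
        gcongr
        rw [Real.enorm_of_nonneg hb0]
        exact ENNReal.ofReal_le_ofReal hbm
    _ = 4 * (ENNReal.ofReal (Real.log m) ^ 2 * volume (Metric.closedBall (0 : ℂ) R) +
          ∫⁻ z in Metric.closedBall (0 : ℂ) R, ‖realPotential ρ z‖ₑ ^ 2) := by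
        rw [lintegral_const_mul' _ _ (by norm_num), lintegral_add_left measurable_const,
          lintegral_const, Measure.restrict_apply_univ]
    _ ≤ _ := by
        gcongr
        refine (lintegral_realPotential_sq_le ρ R).trans ?_
        gcongr
        exact lintegral_empiricalRootMeasure_posLog_le X hn hle hk₀ ω

/-- `n⁻¹ log |P_n|` differs from the potential of the root measure by a constant almost everywhere,
and the Laplacian of a test function has integral zero. -/
theorem integral_empiricalRootMeasure_eq_laplacian {Ω : Type*} {m n : ℕ} (X : ℕ → Fin m → Ω → ℂ)
    {δ : Fin m → ℕ} (hn : 1 ≤ n) (hle : ∀ k, δ k ≤ n) {k₀ : Fin m} (hk₀ : δ k₀ = n) (ω : Ω)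
    {φ : ℂ → ℂ} (hφ : ContDiff ℝ 2 φ) (hc : HasCompactSupport φ) :
    Integrable (fun z => ((n : ℝ)⁻¹ * Real.log ‖∑ k, rootProd X z k (δ k) ω‖) • (Δ φ) z) volume ∧
    ∫ z, φ z ∂(empiricalRootMeasure n (∑ k, rootPoly (fun i => X i k ω) (δ k))) =
      (2 * Real.pi)⁻¹ •
        ∫ z, ((n : ℝ)⁻¹ * Real.log ‖∑ k, rootProd X z k (δ k) ω‖) • (Δ φ) z := by
  obtain ⟨b, -, -, hb⟩ := ae_log_norm_sum_eq X hn hle hk₀ ω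
  set ρ := empiricalRootMeasure n (∑ k, rootPoly (fun i => X i k ω) (δ k))
  have : IsProbabilityMeasure ρ := isProbabilityMeasure_empiricalRootMeasure hn
    (natDegree_sum_rootPoly (fun k i => X i k ω) hle hk₀).1
  have hρ : HasLogMoment ρ := integrable_empiricalRootMeasure hn _ _
  have hΔ := continuous_laplacian hφ
  have hΔc := hasCompactSupport_laplacian hφ hc
  have h1 : Integrable (fun z => realPotential ρ z • (Δ φ) z) volume :=
    (locallyIntegrable_of_memLp_closedBall
      (memLp_realPotential hρ)).integrable_smul_right_of_hasCompactSupport hΔ hΔc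
  have h2 : Integrable (fun z => b • (Δ φ) z) volume :=
    (hΔ.integrable_of_hasCompactSupport hΔc).smul b
  have h3 : (fun z => ((n : ℝ)⁻¹ * Real.log ‖∑ k, rootProd X z k (δ k) ω‖) • (Δ φ) z) =ᵐ[volume]
      fun z => b • (Δ φ) z + realPotential ρ z • (Δ φ) z := by
    filter_upwards [hb] with z hz
    rw [hz, add_smul]
  refine ⟨(h2.add h1).congr h3.symm, ?_⟩
  rw [integral_congr_ae h3, integral_add h2 h1, integral_smul, integral_laplacian_eq_zero hφ hc,
    smul_zero, zero_add, integral_eq_integral_realPotential_smul_laplacian hρ hφ hc]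

namespace IsSample

variable {Ω : Type*} [MeasurableSpace Ω] {P : Measure Ω} [IsProbabilityMeasure P] {m : ℕ}
  {μ : Fin m → Measure ℂ} [∀ k, IsProbabilityMeasure (μ k)] {X : ℕ → Fin m → Ω → ℂ}

theorem measurable_logSize (hX : IsSample P μ X) (n : ℕ) : Measurable (logSize X n) :=
  (Finset.measurable_fun_sum _ fun k _ => Finset.measurable_fun_sum _ fun i _ =>
    ((hX.measurable i k).norm.const_add 1).log).const_mul _

/-- Because `logSize` uses exactly `n` variables of every family, whatever the degrees, its mean
does not depend on `n`. -/
theorem lintegral_logSize (hX : IsSample P μ X) {n : ℕ} (hn : 1 ≤ n) :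
    ∫⁻ ω, ENNReal.ofReal (logSize X n ω) ∂P =
      ∑ k, ∫⁻ w, ENNReal.ofReal (Real.log (1 + ‖w‖)) ∂(μ k) := by
  have hm (i : ℕ) (k : Fin m) :
      Measurable fun ω => ENNReal.ofReal (Real.log (1 + ‖X i k ω‖)) :=
    ((hX.measurable i k).norm.const_add 1).log.ennreal_ofReal
  have h1 (ω : Ω) : ENNReal.ofReal (logSize X n ω) = (n : ℝ≥0∞)⁻¹ *
      ∑ k, ∑ i ∈ Finset.range n, ENNReal.ofReal (Real.log (1 + ‖X i k ω‖)) := by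
    rw [logSize, ENNReal.ofReal_mul (by positivity),
      ENNReal.ofReal_inv_of_pos (by exact_mod_cast hn), ENNReal.ofReal_natCast,
      ENNReal.ofReal_sum_of_nonneg fun k _ => Finset.sum_nonneg fun i _ =>
        log_one_add_norm_nonneg _]
    congr 1
    refine Finset.sum_congr rfl fun k _ => ?_
    rw [ENNReal.ofReal_sum_of_nonneg fun i _ => log_one_add_norm_nonneg _]
  have h2 (i : ℕ) (k : Fin m) : ∫⁻ ω, ENNReal.ofReal (Real.log (1 + ‖X i k ω‖)) ∂P =
      ∫⁻ w, ENNReal.ofReal (Real.log (1 + ‖w‖)) ∂(μ k) := by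
    rw [← hX.law i k, lintegral_map (by fun_prop) (hX.measurable i k)]
  simp_rw [h1]
  rw [lintegral_const_mul _ (Finset.measurable_fun_sum _ fun k _ =>
      Finset.measurable_fun_sum _ fun i _ => hm i k),
    lintegral_finsetSum _ fun k _ => Finset.measurable_fun_sum _ fun i _ => hm i k]
  simp_rw [lintegral_finsetSum _ fun i _ => hm i _, h2, Finset.sum_const, Finset.card_range,
    nsmul_eq_mul]
  rw [← Finset.mul_sum, ← mul_assoc, ENNReal.inv_mul_cancel
    (by exact_mod_cast (by omega : n ≠ 0)) (ENNReal.natCast_ne_top n), one_mul]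

theorem exists_measure_lt_logSize_le (hX : IsSample P μ X) (hlog : ∀ k, HasLogMoment (μ k))
    {η : ℝ≥0∞} (hη : 0 < η) :
    ∃ C : ℝ, ∀ n, 1 ≤ n → P {ω | C < logSize X n ω} ≤ η := by
  set b := ∑ k, ∫⁻ w, ENNReal.ofReal (Real.log (1 + ‖w‖)) ∂(μ k)
  have hb : b ≠ ∞ := (ENNReal.sum_lt_top.2 fun k _ =>
    lintegral_log_one_add_norm_lt_top (hlog k)).ne
  have hlim : Tendsto (fun N : ℕ => b / (N : ℝ≥0∞)) atTop (𝓝 0) := by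
    simpa using ENNReal.Tendsto.const_div ENNReal.tendsto_nat_nhds_top (Or.inr hb)
  obtain ⟨N, hN, hN0⟩ := ((ENNReal.tendsto_nhds_zero.1 hlim η hη).and
    (eventually_gt_atTop 0)).exists
  refine ⟨N, fun n hn => le_trans ?_ hN⟩
  have hsub : {ω | (N : ℝ) < logSize X n ω} ⊆
      {ω | (N : ℝ≥0∞) ≤ ENNReal.ofReal (logSize X n ω)} := fun ω hω => by
    change (N : ℝ≥0∞) ≤ ENNReal.ofReal (logSize X n ω)
    rw [← ENNReal.ofReal_natCast]
    exact ENNReal.ofReal_le_ofReal (le_of_lt hω)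
  refine (measure_mono hsub).trans ?_
  rw [show b = _ from (hX.lintegral_logSize hn).symm]
  exact meas_ge_le_lintegral_div (hX.measurable_logSize n).ennreal_ofReal.aemeasurable
    (by exact_mod_cast hN0.ne') (ENNReal.natCast_ne_top N)

end IsSample

/-! ### Convergence of the root measures -/

namespace IsSample

variable {Ω : Type*} [MeasurableSpace Ω] {P : Measure Ω} [IsProbabilityMeasure P] {m : ℕ}
  {μ : Fin m → Measure ℂ} [∀ k, IsProbabilityMeasure (μ k)] {X : ℕ → Fin m → Ω → ℂ}

/-- Convergence in probability of the normalised logarithms to `U`, in `L¹` of every disc. -/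
theorem tendsto_measure_lintegral_log_norm_sum (hX : IsSample P μ X)
    (hlog : ∀ k, HasLogMoment (μ k)) {d : Fin m → ℕ → ℕ} {k₀ : Fin m}
    (hd_first : ∀ n, 1 ≤ n → d k₀ n = n) (hd_le : ∀ k n, 1 ≤ n → d k n ≤ n) {c : Fin m → ℝ}
    (hc : ∀ k, Tendsto (fun n : ℕ => (d k n : ℝ) / (n : ℝ)) atTop (𝓝 (c k)))
    (hnondeg : ∀ k, ¬ BddAbove (Set.range (d k)) → NonDegenerate (μ k)) (R : ℝ)
    {ε : ℝ≥0∞} (hε : 0 < ε) (hε_top : ε ≠ ∞) :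
    Tendsto (fun n : ℕ => P {ω | ε ≤ ∫⁻ z in Metric.closedBall (0 : ℂ) R,
      ‖(n : ℝ)⁻¹ * Real.log ‖∑ k, rootProd X z k (d k n) ω‖ - (maxPotential c μ z).toReal‖ₑ})
      atTop (𝓝 0) := by
  have hm : 0 < m := k₀.pos
  have hUae := aemeasurable_maxPotential_toReal hm hlog c
  -- `U` is only known to be measurable up to a null set, so a measurable version is used for joint
  -- measurability.
  set V : ℂ → ℝ := hUae.mk _
  have hV : Measurable V := hUae.measurable_mk
  have hUV : (fun z => (maxPotential c μ z).toReal) =ᵐ[volume] V := hUae.ae_eq_mk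
  set B := volume (Metric.closedBall (0 : ℂ) R)
  have hB : B ≠ ∞ := measure_closedBall_lt_top.ne
  have : IsFiniteMeasure (volume.restrict (Metric.closedBall (0 : ℂ) R)) :=
    ⟨by rw [Measure.restrict_apply_univ]; exact measure_closedBall_lt_top⟩
  let f : ℕ → ℂ → Ω → ℝ≥0∞ := fun n z ω =>
    ‖(n : ℝ)⁻¹ * Real.log ‖∑ k, rootProd X z k (d k n) ω‖ - V z‖ₑ
  have hfV (n : ℕ) (ω : Ω) : ∫⁻ z in Metric.closedBall (0 : ℂ) R,
      ‖(n : ℝ)⁻¹ * Real.log ‖∑ k, rootProd X z k (d k n) ω‖ - (maxPotential c μ z).toReal‖ₑ =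
        ∫⁻ z in Metric.closedBall (0 : ℂ) R, f n z ω := by
    refine lintegral_congr_ae ?_
    filter_upwards [ae_restrict_of_ae hUV] with z hz
    simp only [f, ← hz]
  simp_rw [hfV]
  refine tendsto_measure_le_lintegral ?_ ?_ ?_ hε hε_top
  · intro n
    refine Measurable.enorm (Measurable.sub (Measurable.const_mul ?_ _) (hV.comp measurable_fst))
    exact (Finset.measurable_fun_sum _ fun k _ =>
      hX.measurable_uncurry_rootProd k (d k n)).norm.log
  · filter_upwards [ae_restrict_of_ae hX.ae_isGoodPoint, ae_restrict_of_ae hUV] with z hz hzV κ hκ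
    obtain ⟨k, hk, hmax⟩ := exists_maxPotential_eq hm hlog c hz.regular
    have hVz : c k * realPotential (μ k) z = V z := by
      rw [← hzV, hk, EReal.toReal_coe]
    -- Capping at `1` turns a possibly infinite threshold into a positive real one.
    have hκ1 : min κ 1 ≠ ∞ := ne_top_of_le_ne_top ENNReal.one_ne_top (min_le_right _ _)
    have hκ0 : 0 < (min κ 1).toReal :=
      ENNReal.toReal_pos (lt_min hκ one_pos).ne' hκ1
    have h := hX.tendsto_measure_log_norm_sum hlog hz hc hnondeg hVz
      (fun j => hVz ▸ hmax j) hκ0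
    refine tendsto_of_tendsto_of_tendsto_of_le_of_le tendsto_const_nhds h
      (fun _ => zero_le) fun n => measure_mono fun ω hω => ?_
    have h1 : κ ≤ f n z ω := hω
    simp only [f, Real.enorm_eq_ofReal_abs] at h1
    exact ENNReal.toReal_le_of_le_ofReal (abs_nonneg _) ((min_le_left _ _).trans h1)
  · intro η hη
    obtain ⟨C, hC⟩ := hX.exists_measure_lt_logSize_le hlog hη
    have hVsq : ∫⁻ z in Metric.closedBall (0 : ℂ) R, ‖V z‖ₑ ^ 2 ≠ ∞ := by
      have h1 := ((memLp_maxPotential_toReal hm hlog c R).ae_eq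
        (ae_restrict_of_ae hUV)).eLpNorm_lt_top
      have h3 := eLpNorm_nnreal_pow_eq_lintegral (f := V)
        (μ := volume.restrict (Metric.closedBall (0 : ℂ) R)) (p := 2) (by norm_num)
      simp only [NNReal.coe_ofNat, ENNReal.coe_ofNat, ENNReal.rpow_ofNat] at h3
      rw [← h3]
      exact ENNReal.pow_ne_top h1.ne
    -- `D` is the disc bound for the normalised logarithm with `logSize` replaced by its
    -- high-probability bound `C`.
    let D : ℝ≥0∞ := 4 * (ENNReal.ofReal (Real.log m) ^ 2 * B +
        4 * (singularMass + (ENNReal.ofReal (Real.log 2 + Real.posLog R) +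
          ENNReal.ofReal (Real.log m + C)) ^ 2 * B))
    have hD : D ≠ ∞ := by
      have h1 := singularMass_ne_top
      simp only [D]
      finiteness
    refine ⟨4 * (D + ∫⁻ z in Metric.closedBall (0 : ℂ) R, ‖V z‖ₑ ^ 2), by finiteness, ?_⟩
    filter_upwards [eventually_ge_atTop 1] with n hn
    refine le_trans (measure_mono fun ω hω => ?_) (hC n hn)
    by_contra hcon
    have hcon : logSize X n ω ≤ C := not_lt.1 hcon
    have hω' : 4 * (D + ∫⁻ z in Metric.closedBall (0 : ℂ) R, ‖V z‖ₑ ^ 2) <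
        ∫⁻ z in Metric.closedBall (0 : ℂ) R, f n z ω ^ 2 := hω
    refine absurd hω' (not_lt.2 ?_)
    calc ∫⁻ z in Metric.closedBall (0 : ℂ) R, f n z ω ^ 2
        ≤ ∫⁻ z in Metric.closedBall (0 : ℂ) R,
          4 * (‖(n : ℝ)⁻¹ * Real.log ‖∑ k, rootProd X z k (d k n) ω‖‖ₑ ^ 2 + ‖V z‖ₑ ^ 2) := by
          refine lintegral_mono fun z => le_trans ?_ (ennreal_add_sq_le _ _)
          gcongr
          exact enorm_sub_le
      _ = 4 * ((∫⁻ z in Metric.closedBall (0 : ℂ) R,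
            ‖(n : ℝ)⁻¹ * Real.log ‖∑ k, rootProd X z k (d k n) ω‖‖ₑ ^ 2) +
          ∫⁻ z in Metric.closedBall (0 : ℂ) R, ‖V z‖ₑ ^ 2) := by
          rw [lintegral_const_mul' _ _ (by norm_num),
            lintegral_add_right _ (hV.enorm.pow_const 2)]
      _ ≤ _ := by
          gcongr
          refine (lintegral_log_norm_sum_sq_le X hn (fun k => hd_le k n hn)
            (hd_first n hn) ω R).trans ?_
          simp only [D, B]
          gcongr

/-- Convergence in probability of the integrals of a smooth test function. -/
theorem tendsto_measure_integral_smoothTest (hX : IsSample P μ X)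
    (hlog : ∀ k, HasLogMoment (μ k)) {d : Fin m → ℕ → ℕ} {k₀ : Fin m}
    (hd_first : ∀ n, 1 ≤ n → d k₀ n = n) (hd_le : ∀ k n, 1 ≤ n → d k n ≤ n) {c : Fin m → ℝ}
    (hc : ∀ k, Tendsto (fun n : ℕ => (d k n : ℝ) / (n : ℝ)) atTop (𝓝 (c k)))
    (hnondeg : ∀ k, ¬ BddAbove (Set.range (d k)) → NonDegenerate (μ k)) (φ : SmoothTest)
    {ε : ℝ} (hε : 0 < ε) :
    Tendsto (fun n : ℕ => P {ω | ε ≤ ‖∫ z, φ.1 z ∂(empiricalRootMeasure n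
      (∑ k, rootPoly (fun i => X i k ω) (d k n))) -
        (2 * Real.pi)⁻¹ • ∫ z, (maxPotential c μ z).toReal • (Δ φ.1) z‖}) atTop (𝓝 0) := by
  have hm : 0 < m := k₀.pos
  have hφ : ContDiff ℝ 2 φ.1 := by exact_mod_cast contDiff_infty.1 φ.2.1 2
  have hΔ := continuous_laplacian hφ
  have hΔc := hasCompactSupport_laplacian hφ φ.2.2
  obtain ⟨K, hK⟩ := hΔc.exists_bound_of_continuous hΔ
  obtain ⟨R, hR⟩ := hΔc.isCompact.isBounded.subset_closedBall (0 : ℂ)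
  have hK0 : 0 ≤ K := (norm_nonneg _).trans (hK 0)
  have hUint : Integrable (fun z => (maxPotential c μ z).toReal • (Δ φ.1) z) volume :=
    (locallyIntegrable_maxPotential_toReal hm hlog c).integrable_smul_right_of_hasCompactSupport
      hΔ hΔc
  -- `K + 1` replaces the bound `K` on the Laplacian, which may be `0`.
  have hε' : 0 < ENNReal.ofReal (ε / (K + 1)) := ENNReal.ofReal_pos.2 (by positivity)
  have h := hX.tendsto_measure_lintegral_log_norm_sum hlog hd_first hd_le hc hnondeg R hε'
    ENNReal.ofReal_ne_top
  refine tendsto_of_tendsto_of_tendsto_of_le_of_le' tendsto_const_nhds h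
    (Eventually.of_forall fun _ => zero_le) ?_
  filter_upwards [eventually_ge_atTop 1] with n hn
  refine measure_mono fun ω hω => ?_
  obtain ⟨hint, heq⟩ := integral_empiricalRootMeasure_eq_laplacian X hn
    (fun k => hd_le k n hn) (hd_first n hn) ω hφ φ.2.2
  set u : ℂ → ℝ := fun z => (n : ℝ)⁻¹ * Real.log ‖∑ k, rootProd X z k (d k n) ω‖
  have h1 : ε ≤ ‖∫ z, φ.1 z ∂(empiricalRootMeasure n
      (∑ k, rootPoly (fun i => X i k ω) (d k n))) -
        (2 * Real.pi)⁻¹ • ∫ z, (maxPotential c μ z).toReal • (Δ φ.1) z‖ := hω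
  rw [heq, ← smul_sub, ← integral_sub hint hUint, norm_smul] at h1
  have h2 : ‖(2 * Real.pi)⁻¹‖ ≤ 1 := by
    rw [norm_inv, Real.norm_of_nonneg (by positivity)]
    exact inv_le_one_of_one_le₀ (by linarith [Real.pi_gt_three])
  have h3 : ε ≤ ‖∫ z, (u z • (Δ φ.1) z - (maxPotential c μ z).toReal • (Δ φ.1) z)‖ :=
    h1.trans (mul_le_of_le_one_left (norm_nonneg _) h2)
  have h4 : ENNReal.ofReal ε ≤ (∫⁻ z in Metric.closedBall (0 : ℂ) R,
      ‖u z - (maxPotential c μ z).toReal‖ₑ) * ENNReal.ofReal (K + 1) := by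
    calc ENNReal.ofReal ε
        ≤ ‖∫ z, (u z • (Δ φ.1) z - (maxPotential c μ z).toReal • (Δ φ.1) z)‖ₑ := by
          rw [← ofReal_norm]; exact ENNReal.ofReal_le_ofReal h3
      _ ≤ ∫⁻ z, ‖u z • (Δ φ.1) z - (maxPotential c μ z).toReal • (Δ φ.1) z‖ₑ :=
          enorm_integral_le_lintegral_enorm _
      _ ≤ ∫⁻ z, (Metric.closedBall (0 : ℂ) R).indicator (fun z =>
            ‖u z - (maxPotential c μ z).toReal‖ₑ * ENNReal.ofReal (K + 1)) z := by
          refine lintegral_mono fun z => ?_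
          by_cases hz : z ∈ Metric.closedBall (0 : ℂ) R
          · rw [Set.indicator_of_mem hz, ← sub_smul, enorm_smul]
            gcongr
            rw [← ofReal_norm]
            exact ENNReal.ofReal_le_ofReal ((hK z).trans (by linarith))
          · have : (Δ φ.1) z = 0 := image_eq_zero_of_notMem_tsupport fun h => hz (hR h)
            simp [this]
      _ = _ := by
          rw [lintegral_indicator Metric.isClosed_closedBall.measurableSet,
            lintegral_mul_const' _ _ ENNReal.ofReal_ne_top]
  change ENNReal.ofReal (ε / (K + 1)) ≤ _
  rw [ENNReal.ofReal_div_of_pos (by positivity)]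
  exact ENNReal.div_le_of_le_mul h4

/-- The limiting measure exists. -/
theorem exists_limit (hX : IsSample P μ X)
    (hlog : ∀ k, HasLogMoment (μ k)) {d : Fin m → ℕ → ℕ} {k₀ : Fin m}
    (hd_first : ∀ n, 1 ≤ n → d k₀ n = n) (hd_le : ∀ k n, 1 ≤ n → d k n ≤ n) {c : Fin m → ℝ}
    (hc : ∀ k, Tendsto (fun n : ℕ => (d k n : ℝ) / (n : ℝ)) atTop (𝓝 (c k)))
    (hnondeg : ∀ k, ¬ BddAbove (Set.range (d k)) → NonDegenerate (μ k)) :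
    ∃ ρ : ProbabilityMeasure ℂ, ∀ φ : SmoothTest, ∫ z, φ.1 z ∂(ρ : Measure ℂ) =
      (2 * Real.pi)⁻¹ • ∫ z, (maxPotential c μ z).toReal • (Δ φ.1) z := by
  obtain ⟨C, hC⟩ := hX.exists_measure_lt_logSize_le hlog (η := 2⁻¹) (by simp)
  refine exists_probabilityMeasure_of_approx (C := ENNReal.ofReal (Real.log m + C))
    ENNReal.ofReal_ne_top fun F N => ?_
  have hN : (0 : ℝ) < 1 / ((N : ℝ) + 1) := by positivity
  have hF := tendsto_finsetSum_zero (s := F) fun φ _ =>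
    hX.tendsto_measure_integral_smoothTest hlog hd_first hd_le hc hnondeg φ hN
  obtain ⟨n, hnF, hn⟩ := ((hF.eventually_lt_const (u := 2⁻¹) (by simp)).and
    (eventually_ge_atTop 1)).exists
  set bad : SmoothTest → Set Ω := fun φ => {ω | 1 / ((N : ℝ) + 1) ≤
    ‖∫ z, φ.1 z ∂(empiricalRootMeasure n (∑ k, rootPoly (fun i => X i k ω) (d k n))) -
      (2 * Real.pi)⁻¹ • ∫ z, (maxPotential c μ z).toReal • (Δ φ.1) z‖}
  -- The moment event costs at most `1/2` and the finitely many test events less than `1/2`, so some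
  -- outcome avoids them all and its root measure is the required approximation.
  have hlt : P ({ω | C < logSize X n ω} ∪ ⋃ φ ∈ F, bad φ) < 1 := by
    calc P ({ω | C < logSize X n ω} ∪ ⋃ φ ∈ F, bad φ)
        ≤ P {ω | C < logSize X n ω} + ∑ φ ∈ F, P (bad φ) :=
          (measure_union_le _ _).trans (by gcongr; exact measure_biUnion_finset_le _ _)
      _ < 2⁻¹ + 2⁻¹ := ENNReal.add_lt_add_of_le_of_lt (ne_top_of_le_ne_top (by simp) (hC n hn))
          (hC n hn) hnF
      _ = 1 := ENNReal.inv_two_add_inv_two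
  obtain ⟨ω, hω⟩ : ∃ ω, ω ∉ {ω | C < logSize X n ω} ∪ ⋃ φ ∈ F, bad φ := by
    by_contra hcon
    push Not at hcon
    rw [Set.eq_univ_of_forall hcon, measure_univ] at hlt
    exact lt_irrefl _ hlt
  simp only [Set.mem_union, Set.mem_iUnion, not_or, not_exists] at hω
  obtain ⟨hω1, hω2⟩ := hω
  have hω1 : logSize X n ω ≤ C := not_lt.1 hω1
  have hle : ∀ k, d k n ≤ n := fun k => hd_le k n hn
  refine ⟨⟨_, isProbabilityMeasure_empiricalRootMeasure hn
    (natDegree_sum_rootPoly (fun k i => X i k ω) hle (hd_first n hn)).1⟩, ?_, fun φ hφ => ?_⟩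
  · refine (lintegral_empiricalRootMeasure_posLog_le X hn hle (hd_first n hn) ω).trans ?_
    gcongr
  · change ‖_ - _‖ ≤ 1 / ((N : ℝ) + 1)
    exact le_of_not_gt fun h => hω2 φ hφ (le_of_lt h)

/-- Off the event that `logSize` is large the root measures lie in one tight family, where finitely
many smooth tests control `g`. Only these events are estimated, so no measurability of the random
measure is needed. -/
theorem tendstoWeaklyInProbability (hX : IsSample P μ X)
    (hlog : ∀ k, HasLogMoment (μ k)) {d : Fin m → ℕ → ℕ} {k₀ : Fin m}
    (hd_first : ∀ n, 1 ≤ n → d k₀ n = n) (hd_le : ∀ k n, 1 ≤ n → d k n ≤ n) {c : Fin m → ℝ}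
    (hc : ∀ k, Tendsto (fun n : ℕ => (d k n : ℝ) / (n : ℝ)) atTop (𝓝 (c k)))
    (hnondeg : ∀ k, ¬ BddAbove (Set.range (d k)) → NonDegenerate (μ k))
    {ρ : ProbabilityMeasure ℂ} (hρ : ∀ φ : SmoothTest, ∫ z, φ.1 z ∂(ρ : Measure ℂ) =
      (2 * Real.pi)⁻¹ • ∫ z, (maxPotential c μ z).toReal • (Δ φ.1) z) :
    TendstoWeaklyInProbability P (fun n ω => empiricalRootMeasure n
      (∑ k, rootPoly (fun i => X i k ω) (d k n))) ρ := by
  intro g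
  rw [tendstoInMeasure_iff_norm]
  intro ε hε
  rw [ENNReal.tendsto_nhds_zero]
  intro η hη
  have hη2 : 0 < η / 2 := ENNReal.half_pos hη.ne'
  obtain ⟨C, hC⟩ := hX.exists_measure_lt_logSize_le hlog hη2
  obtain ⟨F, N, hFN⟩ := exists_finset_control (C := ENNReal.ofReal (Real.log m + C))
    ENNReal.ofReal_ne_top ρ g hε
  have hN : (0 : ℝ) < 1 / ((N : ℝ) + 1) := by positivity
  have hF := tendsto_finsetSum_zero (s := F) fun φ _ =>
    hX.tendsto_measure_integral_smoothTest hlog hd_first hd_le hc hnondeg φ hN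
  filter_upwards [ENNReal.tendsto_nhds_zero.1 hF _ hη2, eventually_ge_atTop 1] with n hnF hn
  set bad : SmoothTest → Set Ω := fun φ => {ω | 1 / ((N : ℝ) + 1) ≤
    ‖∫ z, φ.1 z ∂(empiricalRootMeasure n (∑ k, rootPoly (fun i => X i k ω) (d k n))) -
      (2 * Real.pi)⁻¹ • ∫ z, (maxPotential c μ z).toReal • (Δ φ.1) z‖}
  have hsub : {ω | ε ≤ ‖∫ z, g z ∂(empiricalRootMeasure n
      (∑ k, rootPoly (fun i => X i k ω) (d k n))) - ∫ z, g z ∂(ρ : Measure ℂ)‖} ⊆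
      {ω | C < logSize X n ω} ∪ ⋃ φ ∈ F, bad φ := by
    intro ω hω
    by_contra hcon
    simp only [Set.mem_union, Set.mem_iUnion, not_or, not_exists] at hcon
    obtain ⟨hω1, hω2⟩ := hcon
    have hω1 : logSize X n ω ≤ C := not_lt.1 hω1
    have hle : ∀ k, d k n ≤ n := fun k => hd_le k n hn
    refine absurd (hFN ⟨_, isProbabilityMeasure_empiricalRootMeasure hn
      (natDegree_sum_rootPoly (fun k i => X i k ω) hle (hd_first n hn)).1⟩ ?_ fun φ hφ => ?_)
      (not_lt.2 hω)
    · refine (lintegral_empiricalRootMeasure_posLog_le X hn hle (hd_first n hn) ω).trans ?_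
      gcongr
    · rw [hρ]
      change ‖_ - _‖ ≤ 1 / ((N : ℝ) + 1)
      exact le_of_not_gt fun h => hω2 φ hφ (le_of_lt h)
  calc _ ≤ P {ω | C < logSize X n ω} + ∑ φ ∈ F, P (bad φ) :=
        (measure_mono hsub).trans ((measure_union_le _ _).trans
          (by gcongr; exact measure_biUnion_finset_le _ _))
    _ ≤ η / 2 + η / 2 := add_le_add (hC n hn) hnF
    _ = η := ENNReal.add_halves η

end IsSample
end RandomPolySum
end

/-! ### The main theorem -/

theorem theorem1p2 {Ω : Type*} [MeasurableSpace Ω] (P : Measure Ω) [IsProbabilityMeasure P]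
    (m : ℕ) (hm : 2 ≤ m)
    (μ : Fin m → Measure ℂ) (hμ : ∀ k, IsProbabilityMeasure (μ k))
    (hlog : ∀ k, RandomPolySum.HasLogMoment (μ k))
    (X : ℕ → Fin m → Ω → ℂ) (hX : ∀ i k, Measurable (X i k))
    (hindep : iIndepFun (fun ik : ℕ × Fin m => X ik.1 ik.2) P)
    (hlaw : ∀ i k, P.map (X i k) = μ k)
    (d : Fin m → ℕ → ℕ)
    (hd_first : ∀ n, 1 ≤ n → d ⟨0, by omega⟩ n = n)
    (hd_le : ∀ k n, 1 ≤ n → d k n ≤ n)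
    (c : Fin m → ℝ) (hc_mem : ∀ k, c k ∈ Set.Icc (0 : ℝ) 1)
    (hc : ∀ k, Tendsto (fun n : ℕ => (d k n : ℝ) / (n : ℝ)) atTop (𝓝 (c k)))
    (hnondeg : ∀ k, ¬ BddAbove (Set.range (d k)) → RandomPolySum.NonDegenerate (μ k)) :
    (∀ᵐ z : ℂ ∂volume, RandomPolySum.maxPotential c μ z ≠ ⊥ ∧ RandomPolySum.maxPotential c μ z ≠ ⊤) ∧
    LocallyIntegrable (fun z : ℂ => (RandomPolySum.maxPotential c μ z).toReal) volume ∧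
    ∃ ρ : Measure ℂ, IsProbabilityMeasure ρ ∧
      RandomPolySum.TendstoWeaklyInProbability P
        (fun n ω => RandomPolySum.empiricalRootMeasure n
          (∑ k, RandomPolySum.rootPoly (fun i => X i k ω) (d k n))) ρ ∧
      RandomPolySum.IsDistribLaplacian ρ (RandomPolySum.maxPotential c μ) ∧
      ∀ ρ' : Measure ℂ, IsProbabilityMeasure ρ' →
        RandomPolySum.IsDistribLaplacian ρ' (RandomPolySum.maxPotential c μ) → ρ' = ρ := by
  have hm0 : 0 < m := by omega
  have hsample : RandomPolySum.IsSample P μ X := ⟨hX, hindep, hlaw⟩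
  refine ⟨RandomPolySum.ae_maxPotential_finite hm0 hlog c,
    RandomPolySum.locallyIntegrable_maxPotential_toReal hm0 hlog c, ?_⟩
  obtain ⟨ρ, hρ⟩ := hsample.exists_limit hlog hd_first hd_le hc hnondeg
  refine ⟨ρ, inferInstance,
    hsample.tendstoWeaklyInProbability hlog hd_first hd_le hc hnondeg hρ,
    fun φ hφ hφc => hρ ⟨φ, hφ, hφc⟩, fun ρ' hρ' hlap => ?_⟩
  exact RandomPolySum.measure_ext_of_smoothTest fun φ =>
    (hlap φ.1 φ.2.1 φ.2.2).trans (hρ φ).symm
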